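/- Let $\mathfrak g$ be a finite-dimensional real semisimple Lie algebra with Killing form $B$, equipped with a gradation $\mathfrak g=\bigoplus_{k\in\mathbb Z}\mathfrak g_k$, $[\mathfrak g_k,\mathfrak g_l]\subset\mathfrak g_{k+l}$. Put $\mathfrak n=\bigoplus_{k>0}\mathfrak g_k$. Assume that the gradation is of type $\alpha_0$, i.e. $\mathfrak g_1$ generates the Lie algebra $\mathfrak n$, and that it is effective, i.e. no nonzero ideal of $\mathfrak g$ is contained in $\mathfrak g_0$ (given type $\alpha_0$ this means that $\mathfrak g$ is generated by $\mathfrak g_1\cup\mathfrak g_{-1}$). Let $Z$ be the characteristic element of the gradation, so that $\mathfrak g_k=\{X:[Z,X]=kX\}$ for all $k$, and let $\sigma$ be a Cartan involution with $\sigma(\mathfrak g_k)=\mathfrak g_{-k}$ for all $k$. Put $B_\sigma(X,Y)=-B(X,\sigma Y)$, a positive definite inner product on $\mathfrak g$. Let $\mathfrak p=\{X:\sigma X=-X\}$ and let $\mathfrak a$ be a maximal abelian subspace of $\mathfrak p$ containing $Z$. Let $H_0\in\mathfrak a$ be the mean curvature vector of the metric Lie algebra $(\mathfrak a+\mathfrak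 n,B_\sigma)$, i.e. $B_\sigma(H_0,A)=\operatorname{tr}(\operatorname{ad}_A|_{\mathfrak n})$ for all $A\in\mathfrak a$. Let $H\in\mathfrak a$ be such that $\operatorname{ad}_H|_{\mathfrak n}$ has only positive eigenvalues, let $c>0$, and consider the solvable Lie algebra $\mathfrak s=\mathbb RH+\mathfrak n$ with the inner product $\langle\,,\rangle^c=c\,B_\sigma|_{\mathbb RH\times\mathbb RH}+B_\sigma|_{\mathfrak n\times\mathfrak n}$ (with $\mathbb RH\perp\mathfrak n$). Let $\mathrm{Ric}^c:\mathfrak s\to\mathfrak s$ be the Ricci operator of the corresponding left-invariant Riemannian metric; $(\mathfrak s,\langle\,,\rangle^c)$ is called Einstein if $\mathrm{Ric}^c=s\cdot\mathrm{id}$ for some $s\in\mathbb R$. Write $H\parallel H_0$ if $H=tH_0$ for some real $t\neq0$. Then: 1. If $(\mathfrak s,\langle\,,\rangle^c)$ is Einstein, then $\mathrm{Ric}^c(H)=-\frac1{2c}H$. 2. If $\mathfrak n$ is abelian, then $(\mathfrak s,\langle\,,\rangle^c)$ is Einstein if and only if $H\parallel H_0$. 3. If $\mathfrak n$ is not abelian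 and $(\mathfrak s,\langle\,,\rangle^c)$ is Einstein, then $c=2$ and $H\parallel H_0$. -/

import Mathlib

open scoped DirectSum

noncomputable section

namespace MetricLie

/-! ### Metric Lie algebras and their Ricci curvature -/

/-- A positive definite inner product on a real vector space. -/
structure InnerProd (L : Type*) [AddCommGroup L] [Module ℝ L] where
  /-- the underlying bilinear form -/
  form : LinearMap.BilinForm ℝ L
  symm : ∀ x y, form x y = form y x
  pos : ∀ x, x ≠ 0 → 0 < form x x

theorem InnerProd.nondegenerate {L : Type*} [AddCommGroup L] [Module ℝ L] (m : InnerProd L) :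
    m.form.Nondegenerate := by
  constructor
  · intro x hx
    by_contra h
    exact (m.pos x h).ne' (hx x)
  · intro x hx
    by_contra h
    exact (m.pos x h).ne' (hx x)

/-- The restriction of an inner product to a subspace. -/
def InnerProd.restrict {L : Type*} [AddCommGroup L] [Module ℝ L] (m : InnerProd L)
    (V : Submodule ℝ L) : InnerProd V where
  form := m.form.domRestrict₁₂ V V
  symm x y := m.symm x y
  pos x hx := m.pos x (fun h => hx (Subtype.ext h))

variable {L : Type*} [LieRing L] [LieAlgebra ℝ L] [Module.Finite ℝ L]

/-- The vector which represents a linear functional with respect to an inner product. -/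
def InnerProd.riesz (m : InnerProd L) : Module.Dual ℝ L →ₗ[ℝ] L :=
  ((m.form.toDual m.nondegenerate).symm : Module.Dual ℝ L →ₗ[ℝ] L)

theorem InnerProd.form_riesz (m : InnerProd L) (f : Module.Dual ℝ L) (x : L) :
    m.form (m.riesz f) x = f x :=
  LinearMap.BilinForm.apply_toDual_symm_apply f x

/-- The right-hand side of Koszul's formula for left-invariant vector fields,
`⟨[X,Y],W⟩ - ⟨[Y,W],X⟩ + ⟨[W,X],Y⟩`, as a functional of `W`. -/
def koszul (m : InnerProd L) : L →ₗ[ℝ] L →ₗ[ℝ] Module.Dual ℝ L :=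
  LinearMap.mk₂ ℝ
    (fun X Y =>
      { toFun := fun W => m.form ⁅X, Y⁆ W - m.form ⁅Y, W⁆ X + m.form ⁅W, X⁆ Y
        map_add' := fun W W' => by simp only [lie_add, add_lie, map_add, LinearMap.add_apply]; ring
        map_smul' := fun t W => by
          simp only [lie_smul, smul_lie, map_smul, LinearMap.smul_apply, smul_eq_mul,
            RingHom.id_apply]
          ring })
    (fun X X' Y => LinearMap.ext fun W => by
      simp only [lie_add, add_lie, map_add, LinearMap.add_apply, LinearMap.coe_mk, AddHom.coe_mk]
      ring)
    (fun t X Y => LinearMap.ext fun W => by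
      simp only [lie_smul, smul_lie, map_smul, LinearMap.smul_apply, smul_eq_mul,
        LinearMap.coe_mk, AddHom.coe_mk]
      ring)
    (fun X Y Y' => LinearMap.ext fun W => by
      simp only [lie_add, add_lie, map_add, LinearMap.add_apply, LinearMap.coe_mk, AddHom.coe_mk]
      ring)
    (fun t X Y => LinearMap.ext fun W => by
      simp only [lie_smul, smul_lie, map_smul, LinearMap.smul_apply, smul_eq_mul,
        LinearMap.coe_mk, AddHom.coe_mk]
      ring)

/-- The Levi-Civita connection `∇_X Y` of the left-invariant metric, on left-invariant vector
fields: `2⟨∇_X Y, W⟩ = ⟨[X,Y],W⟩ - ⟨[Y,W],X⟩ + ⟨[W,X],Y⟩`. -/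
def leviCivita (m : InnerProd L) : L →ₗ[ℝ] L →ₗ[ℝ] L :=
  (1 / 2 : ℝ) • (koszul m).compr₂ m.riesz

/-- The Riemann curvature `R(X,Y)W = ∇_X ∇_Y W - ∇_Y ∇_X W - ∇_[X,Y] W`. -/
def curvature (m : InnerProd L) (X Y W : L) : L :=
  leviCivita m X (leviCivita m Y W) - leviCivita m Y (leviCivita m X W) - leviCivita m ⁅X, Y⁆ W

/-- The endomorphism `X ↦ R(X,Y)W`. -/
def jacobi (m : InnerProd L) (Y W : L) : L →ₗ[ℝ] L where
  toFun X := curvature m X Y W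
  map_add' X X' := by
    simp only [curvature, map_add, LinearMap.add_apply, add_lie]; abel
  map_smul' t X := by
    simp only [curvature, map_smul, LinearMap.smul_apply, smul_lie, smul_sub, RingHom.id_apply]

/-- The Ricci tensor `ric(Y,W) = tr(X ↦ R(X,Y)W)`. -/
def ricciForm (m : InnerProd L) : LinearMap.BilinForm ℝ L :=
  LinearMap.mk₂ ℝ (fun Y W => LinearMap.trace ℝ L (jacobi m Y W))
    (fun Y Y' W => by
      rw [← map_add]; congr 1; ext X
      simp only [jacobi, curvature, map_add, LinearMap.add_apply, lie_add, LinearMap.coe_mk,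
        AddHom.coe_mk]
      abel)
    (fun t Y W => by
      rw [← map_smul]; congr 1; ext X
      simp only [jacobi, curvature, map_smul, LinearMap.smul_apply, lie_smul, LinearMap.coe_mk,
        AddHom.coe_mk, smul_sub])
    (fun Y W W' => by
      rw [← map_add]; congr 1; ext X
      simp only [jacobi, curvature, map_add, LinearMap.add_apply, LinearMap.coe_mk,
        AddHom.coe_mk]
      abel)
    (fun t Y W => by
      rw [← map_smul]; congr 1; ext X
      simp only [jacobi, curvature, map_smul, LinearMap.smul_apply, LinearMap.coe_mk,
        AddHom.coe_mk, smul_sub])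

/-- The Ricci operator: `⟨Ric(X), Y⟩ = ric(X,Y)`. -/
def ricci (m : InnerProd L) : L →ₗ[ℝ] L :=
  m.riesz ∘ₗ ricciForm m

/-- The metric Lie algebra is Einstein: the Ricci operator is a multiple of the identity. -/
def IsEinstein (m : InnerProd L) : Prop :=
  ∃ s : ℝ, ∀ X : L, ricci m X = s • X

/-- The mean curvature vector: the vector `H₀` with `⟨H₀, A⟩ = tr(ad_A)`. -/
def meanCurvatureVector (m : InnerProd L) : L :=
  m.riesz (LinearMap.trace ℝ L ∘ₗ (LieAlgebra.ad ℝ L : L →ₗ[ℝ] Module.End ℝ L))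

/-- The mean curvature vector is orthogonal to `[L, L]`. -/
theorem meanCurvatureVector_orthogonal (m : InnerProd L) (X Y : L) :
    m.form (meanCurvatureVector m) ⁅X, Y⁆ = 0 := by
  rw [meanCurvatureVector, InnerProd.form_riesz]
  simp [LieHom.map_lie, Ring.lie_def, LinearMap.trace_mul_comm ℝ (LieAlgebra.ad ℝ L X)]

end MetricLie

namespace GradedLie

open MetricLie

variable {g : Type*} [LieRing g] [LieAlgebra ℝ g]

/-! ### Cartan involutions -/

/-- A Cartan involution: an involutive automorphism `σ` such that `-B(X, σ X) > 0` for `X ≠ 0`,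
where `B` is the Killing form. -/
structure IsCartanInvolution (σ : g ≃ₗ⁅ℝ⁆ g) : Prop where
  invol : ∀ X, σ (σ X) = X
  pos : ∀ X, X ≠ 0 → 0 < -killingForm ℝ g X (σ X)

/-- The inner product `B_σ(X,Y) = -B(X, σ Y)`. -/
def cartanInner {σ : g ≃ₗ⁅ℝ⁆ g} (hσ : IsCartanInvolution σ) : InnerProd g where
  form := -(killingForm ℝ g).compl₂ (σ : g →ₗ[ℝ] g)
  symm X Y := by
    have h := LieAlgebra.killingForm_of_equiv_apply (R := ℝ) σ X (σ Y)
    rw [hσ.invol] at h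
    have h' : killingForm ℝ g X (σ Y) = killingForm ℝ g Y (σ X) := by
      rw [← h, LieModule.traceForm_comm]
    simpa using h'
  pos X hX := by simpa using hσ.pos X hX

/-- `𝔭`, the `(-1)`-eigenspace of `σ`. -/
def pSpace (σ : g ≃ₗ⁅ℝ⁆ g) : Submodule ℝ g where
  carrier := {X | σ X = -X}
  add_mem' {X Y} hX hY := by
    simp only [Set.mem_ofPred_eq] at *
    rw [map_add, hX, hY]; abel
  zero_mem' := by simp
  smul_mem' t X hX := by
    simp only [Set.mem_ofPred_eq] at *
    rw [map_smul, hX, smul_neg]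

/-- The elements of `V` commute with each other. -/
def IsAbelianSubspace (V : Submodule ℝ g) : Prop :=
  ∀ X ∈ V, ∀ Y ∈ V, ⁅X, Y⁆ = 0

/-- `𝔞` is a maximal abelian subspace of `𝔭`. -/
def IsMaximalAbelian (σ : g ≃ₗ⁅ℝ⁆ g) (𝔞 : Submodule ℝ g) : Prop :=
  Maximal (fun V : Submodule ℝ g => V ≤ pSpace σ ∧ IsAbelianSubspace V) 𝔞

/-! ### Gradations -/

/-- `σ` is grade-reversing: `σ(𝔤_k) = 𝔤_{-k}`. -/
def IsGradeReversing (𝒢 : ℤ → Submodule ℝ g) (σ : g ≃ₗ⁅ℝ⁆ g) : Prop :=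
  ∀ k, (𝒢 k).map (σ : g →ₗ[ℝ] g) = 𝒢 (-k)

/-- `Z` is the characteristic element: `𝔤_k = {X | [Z,X] = k X}` for every `k`. -/
def IsCharacteristicElement (𝒢 : ℤ → Submodule ℝ g) (Z : g) : Prop :=
  ∀ (k : ℤ) (X : g), X ∈ 𝒢 k ↔ ⁅Z, X⁆ = (k : ℝ) • X

/-- A subspace that is abelian and contains the characteristic element lies in `𝔤_0`. -/
theorem le_grade_zero {𝒢 : ℤ → Submodule ℝ g} {Z : g} (hZ : IsCharacteristicElement 𝒢 Z)
    {V : Submodule ℝ g} (hV : IsAbelianSubspace V) (hZV : Z ∈ V) : V ≤ 𝒢 0 := fun X hX => by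
  rw [hZ, hV Z hZV X hX]; simp

theorem IsMaximalAbelian.mem_grade_zero {𝒢 : ℤ → Submodule ℝ g} {Z : g}
    (hZ : IsCharacteristicElement 𝒢 Z) {σ : g ≃ₗ⁅ℝ⁆ g} {𝔞 : Submodule ℝ g}
    (h𝔞 : IsMaximalAbelian σ 𝔞) (hZ𝔞 : Z ∈ 𝔞) {H : g} (hH : H ∈ 𝔞) : H ∈ 𝒢 0 :=
  le_grade_zero hZ h𝔞.prop.2 hZ𝔞 hH

/-- The characteristic element of a gradation exists as soon as there is a Cartan involution. -/
theorem exists_isCharacteristicElement [Module.Finite ℝ g] (𝒢 : ℤ → Submodule ℝ g)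
    [GradedLieAlgebra 𝒢] {σ : g ≃ₗ⁅ℝ⁆ g} (hσ : IsCartanInvolution σ) :
    ∃ Z, IsCharacteristicElement 𝒢 Z := by
  have : LieAlgebra.IsKilling ℝ g := by
    constructor
    rw [eq_bot_iff]
    intro X hX
    by_contra h
    have h1 := (LieIdeal.mem_killingCompl ℝ g ⊤).1 hX (σ X) trivial
    rw [LieModule.traceForm_comm] at h1
    exact (hσ.pos X (by simpa using h)).ne' (by simpa using h1)
  obtain ⟨Z, hZ⟩ := LieDerivation.IsKilling.exists_eq_ad
    (LieDerivation.ofGrading 𝒢 (Int.castAddHom ℝ))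
  have hom : ∀ (k : ℤ) (X : g), X ∈ 𝒢 k → ⁅Z, X⁆ = (k : ℝ) • X := fun k X hX => by
    have h := LieDerivation.ofGrading_apply_apply 𝒢 (Int.castAddHom ℝ) hX
    rw [← hZ] at h
    simpa using h
  let P : ℤ → g →ₗ[ℝ] g := fun j => (𝒢 j).subtype ∘ₗ
    DirectSum.component ℝ ℤ (fun k => 𝒢 k) j ∘ₗ
      (DirectSum.decomposeLinearEquiv 𝒢 : g →ₗ[ℝ] ⨁ k, 𝒢 k)
  have hP : ∀ j Y, P j Y = (DirectSum.decompose 𝒢 Y j : g) := fun _ _ => rfl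
  have comp : ∀ (j : ℤ) (Y : g), P j ⁅Z, Y⁆ = (j : ℝ) • P j Y := fun j Y => by
    induction Y using DirectSum.Decomposition.inductionOn 𝒢 with
    | zero => simp
    | @homogeneous i y =>
      rw [hom i y y.2, map_smul]
      by_cases h : i = j
      · subst h; rfl
      · rw [hP, DirectSum.decompose_of_mem_ne 𝒢 y.2 h, smul_zero, smul_zero]
    | add y y' h h' => rw [lie_add, map_add, map_add, h, h', smul_add]
  refine ⟨Z, fun k X => ⟨hom k X, fun hX => ?_⟩⟩
  classical
  rw [← DirectSum.sum_support_decompose 𝒢 X]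
  refine Submodule.sum_mem _ fun j _ => ?_
  by_cases h : j = k
  · subst h; exact (DirectSum.decompose 𝒢 X j).2
  · have h1 := comp j X
    rw [hX, map_smul, ← sub_eq_zero, ← sub_smul, smul_eq_zero, sub_eq_zero, hP] at h1
    rcases h1 with h1 | h1
    · exact absurd (by exact_mod_cast h1.symm) h
    · rw [h1]; exact zero_mem _

section graded

variable (𝒢 : ℤ → Submodule ℝ g) [GradedLieAlgebra 𝒢]

/-- The nilpotent subalgebra `𝔫 = ∑_{k>0} 𝔤_k`. -/
def nil : LieSubalgebra ℝ g where
  toSubmodule := ⨆ k : {k : ℤ // 0 < k}, 𝒢 k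
  lie_mem' {X Y} hX hY := by
    simp only [AddSubsemigroup.mem_carrier, AddSubmonoid.mem_toSubsemigroup,
      Submodule.mem_toAddSubmonoid] at *
    induction hX using Submodule.iSup_induction' with
    | mem i x hx =>
      induction hY using Submodule.iSup_induction' with
      | mem j y hy =>
        exact Submodule.mem_iSup_of_mem ⟨(i : ℤ) + j, add_pos i.2 j.2⟩
          (SetLike.GradedBracket.bracket_mem hx hy)
      | zero => simp
      | add y y' _ _ h h' => rw [lie_add]; exact add_mem h h'
    | zero => simp
    | add x x' _ _ h h' => rw [add_lie]; exact add_mem h h'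

theorem lie_grade_zero_mem_nil {A X : g} (hA : A ∈ 𝒢 0) (hX : X ∈ nil 𝒢) : ⁅A, X⁆ ∈ nil 𝒢 := by
  change X ∈ ⨆ k : {k : ℤ // 0 < k}, 𝒢 k at hX
  change ⁅A, X⁆ ∈ ⨆ k : {k : ℤ // 0 < k}, 𝒢 k
  induction hX using Submodule.iSup_induction' with
  | mem j y hy =>
    refine Submodule.mem_iSup_of_mem j ?_
    simpa using SetLike.GradedBracket.bracket_mem (ℒ := 𝒢) hA hy
  | zero => simp
  | add y y' _ _ h h' => rw [lie_add]; exact add_mem h h'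

/-- The gradation is of type `α₀`: `𝔤_1` generates `∑_{k>0} 𝔤_k`. -/
def IsTypeAlphaZero : Prop :=
  LieSubalgebra.lieSpan ℝ g (𝒢 1 : Set g) = nil 𝒢

/-- The projection of `𝔤 = ⨁ 𝔤_k` onto `𝔤_0`. -/
def projZero : g →ₗ[ℝ] g :=
  (𝒢 0).subtype ∘ₗ DirectSum.component ℝ ℤ (fun k => 𝒢 k) 0 ∘ₗ
    (DirectSum.decomposeLinearEquiv 𝒢 : g →ₗ[ℝ] ⨁ k, 𝒢 k)

/-- The inner product `c B_σ(X_0, Y_0) + B_σ(X - X_0, Y - Y_0)`, where `X_0` is the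
`𝔤_0`-component of `X`. On `V + 𝔫` with `V ⊆ 𝔤_0` one has `X_0 ∈ V` and `X - X_0 ∈ 𝔫`, so that
there it is the orthogonal sum of `c B_σ` on `V` and `B_σ` on `𝔫`. -/
def scaledInner {σ : g ≃ₗ⁅ℝ⁆ g} (hσ : IsCartanInvolution σ) (c : ℝ) (hc : 0 < c) : InnerProd g where
  form := c • (cartanInner hσ).form.compl₁₂ (projZero 𝒢) (projZero 𝒢) +
    (cartanInner hσ).form.compl₁₂ (LinearMap.id - projZero 𝒢) (LinearMap.id - projZero 𝒢)
  symm X Y := by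
    simp only [LinearMap.add_apply, LinearMap.smul_apply, LinearMap.compl₁₂_apply]
    exact congrArg₂ (fun a b => c • a + b) ((cartanInner hσ).symm _ _)
      ((cartanInner hσ).symm _ _)
  pos X hX := by
    have nn : ∀ Y, 0 ≤ (cartanInner hσ).form Y Y := fun Y => by
      by_cases h : Y = 0
      · simp [h]
      · exact ((cartanInner hσ).pos Y h).le
    simp only [LinearMap.add_apply, LinearMap.smul_apply, LinearMap.compl₁₂_apply, smul_eq_mul]
    by_cases h : projZero 𝒢 X = 0
    · simpa [h] using (cartanInner hσ).pos X hX
    · exact add_pos_of_pos_of_nonneg (mul_pos hc ((cartanInner hσ).pos _ h)) (nn _)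

variable {𝒢}

/-- The solvable extension `V + 𝔫` of `𝔫` by an abelian subspace `V` of `𝔤_0`. -/
def extension (V : Submodule ℝ g) (hV : IsAbelianSubspace V) (hV0 : V ≤ 𝒢 0) :
    LieSubalgebra ℝ g where
  toSubmodule := V ⊔ (nil 𝒢).toSubmodule
  lie_mem' {X Y} hX hY := by
    simp only [AddSubsemigroup.mem_carrier, AddSubmonoid.mem_toSubsemigroup,
      Submodule.mem_toAddSubmonoid] at *
    obtain ⟨A, hA, U, hU, rfl⟩ := Submodule.mem_sup.1 hX
    obtain ⟨A', hA', U', hU', rfl⟩ := Submodule.mem_sup.1 hY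
    refine Submodule.mem_sup_right ?_
    change _ ∈ nil 𝒢
    rw [add_lie, lie_add, lie_add, hV A hA A' hA', zero_add, ← lie_skew U A']
    exact add_mem (lie_grade_zero_mem_nil 𝒢 (hV0 hA) hU')
      (add_mem (neg_mem (lie_grade_zero_mem_nil 𝒢 (hV0 hA') hU)) ((nil 𝒢).lie_mem hU hU'))

end graded

theorem isAbelianSubspace_span (H : g) : IsAbelianSubspace (Submodule.span ℝ {H}) := by
  intro X hX Y hY
  obtain ⟨a, rfl⟩ := Submodule.mem_span_singleton.1 hX
  obtain ⟨b, rfl⟩ := Submodule.mem_span_singleton.1 hY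
  simp

variable {𝒢 : ℤ → Submodule ℝ g} [GradedLieAlgebra 𝒢]

/-- The one-dimensional extension `𝔰 = ℝH + 𝔫` for `H ∈ 𝔤_0`. -/
def lineExtension {H : g} (hH : H ∈ 𝒢 0) : LieSubalgebra ℝ g :=
  extension (𝒢 := 𝒢) (Submodule.span ℝ {H}) (isAbelianSubspace_span H)
    ((Submodule.span_singleton_le_iff_mem H (𝒢 0)).2 hH)

/-- `H` as an element of `ℝH + 𝔫`. -/
def lineElement {H : g} (hH : H ∈ 𝒢 0) : lineExtension (𝒢 := 𝒢) hH :=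
  ⟨H, Submodule.mem_sup_left (Submodule.mem_span_singleton_self H)⟩

/-- The inner product `⟨,⟩^c = c B_σ|_{ℝH × ℝH} + B_σ|_{𝔫 × 𝔫}` on `ℝH + 𝔫`. -/
def lineInner {σ : g ≃ₗ⁅ℝ⁆ g} (hσ : IsCartanInvolution σ) {H : g} (hH : H ∈ 𝒢 0)
    (c : ℝ) (hc : 0 < c) : InnerProd (lineExtension (𝒢 := 𝒢) hH) :=
  (scaledInner 𝒢 hσ c hc).restrict (lineExtension (𝒢 := 𝒢) hH).toSubmodule

/-- The mean curvature vector `H₀` of the metric Lie algebra `(𝔞 + 𝔫, B_σ)`, as an element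
of `𝔤`. -/
def meanCurvature [Module.Finite ℝ g] {σ : g ≃ₗ⁅ℝ⁆ g} (hσ : IsCartanInvolution σ)
    {𝔞 : Submodule ℝ g} (h𝔞 : IsAbelianSubspace 𝔞) (h𝔞0 : 𝔞 ≤ 𝒢 0) : g :=
  (meanCurvatureVector (L := extension (𝒢 := 𝒢) 𝔞 h𝔞 h𝔞0)
    ((cartanInner hσ).restrict (extension (𝒢 := 𝒢) 𝔞 h𝔞 h𝔞0).toSubmodule) :
      extension (𝒢 := 𝒢) 𝔞 h𝔞 h𝔞0)

/-- `X` and `Y` are parallel. -/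
def Parallel (X Y : g) : Prop := ∃ t : ℝ, t ≠ 0 ∧ X = t • Y

end GradedLie

end

open MetricLie GradedLie

/-! For any metric Lie algebra put `D_Y = (X ↦ ∇_X Y)`. Since `∇` is torsion free and each `∇_Y` is
skew, `ric(Y,W) = -tr ad(∇_Y W) - tr(D_Y D_W)` (`ricciForm_eq`).

The crux is `trace_nilDeriv_mul_nilDeriv`: in terms of `B_σ`, the Ricci operator of `𝔫` is `1/2
ad_{H₀} - 1/4`. There `-2 D_Y` on `𝔫` is the compression of `ad_Y - ad_{σY} + ad_Y σ`. The first two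
terms form a symmetric operator, the last a skew one, so cross traces vanish. The remaining traces
combine into the Killing form, which gives the constant, and `tr(ad_{[σW,Y]}|𝔫) = B_σ([H₀,Y],W)`.

In `𝔰 = ℝH + 𝔫` the operator `ad_H` is symmetric and `∇_H = 0`. Hence `ric(H,H) = -tr(ad_H²|𝔫)`,
while on `𝔫` the Ricci operator is `-a ad_H + 1/2 ad_{H₀} - 1/4` with `a = tr(ad_H|𝔫) / (c|H|²) >
0`. The Einstein equation with constant `s` therefore makes the derivation `ad(1/2 H₀ - aH)` act on
`𝔫` as the scalar `s + 1/4`.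

If `𝔫` is not abelian, a scalar derivation vanishes, so `s = -1/4`; if `𝔫` is abelian, the crux
forces `ad_{H₀} = 1/2` on `𝔫`, so `ad_H` is scalar too. In both cases a combination of `H` and `H₀`
centralizes `𝔫`, and effectiveness makes it zero (`eq_zero_of_lie_nil_eq_zero`): `H ∥ H₀`. Then `H`
is central in `𝔤_0`, so `|H|² = B(H,H) = 2 tr(ad_H²|𝔫)`, and comparison with `ric(H,H) = s c |H|²`
gives `s = -1/(2c)`. Together with `s = -1/4` this is `c = 2`. -/

namespace MetricLie

/-! ### Traces of adjoint operators, and a trace formula for the Ricci form -/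

theorem InnerProd.ext_form {V : Type*} [AddCommGroup V] [Module ℝ V] (m : InnerProd V) {x y : V}
    (h : ∀ w, m.form x w = m.form y w) : x = y := by
  refine sub_eq_zero.1 (m.nondegenerate.1 _ fun w => ?_)
  rw [map_sub, LinearMap.sub_apply, h, sub_self]

/-- Operators which are adjoint to each other have the same trace. -/
theorem InnerProd.trace_eq_of_isAdjointPair {V : Type*} [AddCommGroup V] [Module ℝ V]
    [Module.Finite ℝ V] (m : InnerProd V) {f f' : Module.End ℝ V}
    (h : m.form.IsAdjointPair m.form f f') : LinearMap.trace ℝ V f = LinearMap.trace ℝ V f' := by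
  -- The isomorphism `x ↦ ⟨x, ·⟩` with the dual space conjugates `f` into the transpose of its
  -- adjoint `f'`.
  have key : Module.Dual.transpose f' = (m.form.toDual m.nondegenerate).conj f := by
    ext φ w
    obtain ⟨x, rfl⟩ := (m.form.toDual m.nondegenerate).surjective φ
    simp only [Module.Dual.transpose_apply, LinearMap.comp_apply, LinearEquiv.conj_apply,
      LinearEquiv.coe_coe, LinearEquiv.symm_apply_apply]
    exact (h x w).symm
  rw [← LinearMap.trace_transpose' f', key, LinearMap.trace_conj']

theorem InnerProd.trace_eq_zero_of_isAdjointPair_neg {V : Type*} [AddCommGroup V] [Module ℝ V]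
    [Module.Finite ℝ V] (m : InnerProd V) {f : Module.End ℝ V}
    (h : m.form.IsAdjointPair m.form f (-f : Module.End ℝ V)) : LinearMap.trace ℝ V f = 0 := by
  have h1 := m.trace_eq_of_isAdjointPair h
  rw [map_neg] at h1
  linarith

/-- The trace of a symmetric operator with positive eigenvalues is positive. -/
theorem InnerProd.trace_pos_of_eigenvalues_pos {V : Type*} [AddCommGroup V] [Module ℝ V]
    [Module.Finite ℝ V] [Nontrivial V] (m : InnerProd V) {f : Module.End ℝ V}
    (h : m.form.IsAdjointPair m.form f f)
    (hpos : ∀ (μ : ℝ) (X : V), X ≠ 0 → f X = μ • X → 0 < μ) : 0 < LinearMap.trace ℝ V f := by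
  let core : InnerProductSpace.Core ℝ V :=
    { inner := fun x y => m.form x y
      conj_inner_symm := fun x y => m.symm y x
      re_inner_nonneg := fun x => by
        by_cases hx : x = 0
        · simp [hx]
        · exact (m.pos x hx).le
      add_left := fun x y z => by simp
      smul_left := fun x y r => by simp
      definite := fun x hx => by
        by_contra hne
        exact (m.pos x hne).ne' hx }
  let _ : NormedAddCommGroup V := core.toNormedAddCommGroup
  let _ : InnerProductSpace ℝ V := InnerProductSpace.ofCore core.toCore
  have hs : LinearMap.IsSymmetric f := fun x y => h x y
  rw [hs.trace_eq_sum_eigenvalues rfl]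
  have : Nonempty (Fin (Module.finrank ℝ V)) :=
    ⟨⟨0, Module.finrank_pos⟩⟩
  refine Finset.sum_pos (fun i _ => ?_) (Finset.univ_nonempty_iff.2 this)
  obtain ⟨X, hX⟩ := (hs.hasEigenvalue_eigenvalues rfl i).exists_hasEigenvector
  exact hpos _ X hX.2 hX.apply_eq_smul

variable {L : Type*} [LieRing L] [LieAlgebra ℝ L] [Module.Finite ℝ L]

theorem form_leviCivita (m : InnerProd L) (X Y W : L) :
    m.form (leviCivita m X Y) W =
      1 / 2 * (m.form ⁅X, Y⁆ W - m.form ⁅Y, W⁆ X + m.form ⁅W, X⁆ Y) := by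
  have h : leviCivita m X Y = (1 / 2 : ℝ) • m.riesz (koszul m X Y) := rfl
  rw [h, map_smul, LinearMap.smul_apply, InnerProd.form_riesz]
  rfl

theorem leviCivita_sub_leviCivita (m : InnerProd L) (X Y : L) :
    leviCivita m X Y - leviCivita m Y X = ⁅X, Y⁆ := by
  refine m.ext_form fun w => ?_
  rw [map_sub, LinearMap.sub_apply, form_leviCivita, form_leviCivita, ← lie_skew Y X,
    ← lie_skew w X, ← lie_skew w Y]
  simp only [map_neg, LinearMap.neg_apply]
  ring

theorem form_leviCivita_right (m : InnerProd L) (X Y W : L) :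
    m.form (leviCivita m X Y) W = -m.form Y (leviCivita m X W) := by
  rw [m.symm Y, form_leviCivita, form_leviCivita, ← lie_skew Y W, ← lie_skew X W, ← lie_skew Y X]
  simp only [map_neg, LinearMap.neg_apply]
  ring

/-- The covariant derivative `X ↦ ∇_X Y` of a left-invariant vector field. -/
noncomputable def covDeriv (m : InnerProd L) (Y : L) : Module.End ℝ L :=
  (leviCivita m).flip Y

theorem covDeriv_apply (m : InnerProd L) (X Y : L) : covDeriv m Y X = leviCivita m X Y := rfl

theorem covDeriv_eq (m : InnerProd L) (Y : L) :
    covDeriv m Y = leviCivita m Y - LieAlgebra.ad ℝ L Y := by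
  ext X
  rw [LinearMap.sub_apply, LieAlgebra.ad_apply, ← leviCivita_sub_leviCivita m, covDeriv_apply]
  abel

/-- Metric compatibility makes `∇_Y` skew, hence traceless; only the torsion term `-ad_Y`
contributes. -/
theorem trace_covDeriv (m : InnerProd L) (Y : L) :
    LinearMap.trace ℝ L (covDeriv m Y) = -LinearMap.trace ℝ L (LieAlgebra.ad ℝ L Y) := by
  rw [covDeriv_eq, map_sub, m.trace_eq_zero_of_isAdjointPair_neg (f := leviCivita m Y), zero_sub]
  intro X W
  rw [form_leviCivita_right, LinearMap.neg_apply, map_neg]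

/-- Torsion-freeness rewrites `X ↦ R(X,Y)W` as `D_{∇_Y W} - ∇_Y D_W + D_W ad_Y`. Under the trace the
last two terms merge, since `D_Y = ∇_Y - ad_Y`. -/
theorem ricciForm_eq (m : InnerProd L) (Y W : L) :
    ricciForm m Y W = -LinearMap.trace ℝ L (LieAlgebra.ad ℝ L (leviCivita m Y W)) -
      LinearMap.trace ℝ L (covDeriv m Y * covDeriv m W) := by
  have h : jacobi m Y W = covDeriv m (leviCivita m Y W) - leviCivita m Y * covDeriv m W +
      covDeriv m W * LieAlgebra.ad ℝ L Y := by
    ext X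
    simp only [LinearMap.add_apply, LinearMap.sub_apply, Module.End.mul_apply,
      LieAlgebra.ad_apply, covDeriv_apply]
    change curvature m X Y W = _
    rw [curvature, ← lie_skew X Y, map_neg, LinearMap.neg_apply]
    abel
  change LinearMap.trace ℝ L (jacobi m Y W) = _
  rw [h, map_add, map_sub, trace_covDeriv, LinearMap.trace_mul_comm ℝ (covDeriv m W),
    covDeriv_eq m Y, sub_mul, map_sub]
  ring

theorem ricci_eq_smul_iff (m : InnerProd L) {s : ℝ} :
    (∀ X, ricci m X = s • X) ↔ ∀ X Y, ricciForm m X Y = s * m.form X Y := by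
  refine forall_congr' fun X => ?_
  have h (Y : L) : m.form (ricci m X) Y = ricciForm m X Y := m.form_riesz _ _
  refine ⟨fun hX Y => ?_, fun hX => m.ext_form fun Y => ?_⟩
  · rw [← h, hX, map_smul, LinearMap.smul_apply, smul_eq_mul]
  · rw [h, hX, map_smul, LinearMap.smul_apply, smul_eq_mul]

/-- The mean curvature vector is characterized by `⟨H₀, A⟩ = tr(ad_A)`. -/
theorem eq_meanCurvatureVector (m : InnerProd L) {h : L}
    (hh : ∀ A, m.form h A = LinearMap.trace ℝ L (LieAlgebra.ad ℝ L A)) :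
    meanCurvatureVector m = h := by
  refine m.ext_form fun A => ?_
  rw [hh, meanCurvatureVector, InnerProd.form_riesz]
  rfl

end MetricLie

/-! ### Projections along the gradation, and adjoints with respect to `B_σ` -/

namespace GradedLie

variable {g : Type*} [LieRing g] [LieAlgebra ℝ g]

section proj

variable (𝒢 : ℤ → Submodule ℝ g) [GradedLieAlgebra 𝒢]

/-- The projection of `𝔤 = ⨁ 𝔤_k` onto `⨁_{k ∈ S} 𝔤_k`. -/
noncomputable def proj (S : Set ℤ) : Module.End ℝ g :=
  open Classical in
  (DirectSum.toModule ℝ ℤ g fun k => if k ∈ S then (𝒢 k).subtype else 0) ∘ₗ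
    (DirectSum.decomposeLinearEquiv 𝒢 : g →ₗ[ℝ] DirectSum ℤ fun k => 𝒢 k)

variable {𝒢}

open Classical in
theorem proj_apply_of_mem (S : Set ℤ) {k : ℤ} {X : g} (hX : X ∈ 𝒢 k) :
    proj 𝒢 S X = (if k ∈ S then (𝒢 k).subtype else 0) ⟨X, hX⟩ := by
  have h : DirectSum.decomposeLinearEquiv 𝒢 X =
      DirectSum.lof ℝ ℤ (fun k => 𝒢 k) k ⟨X, hX⟩ := DirectSum.decompose_of_mem 𝒢 hX
  rw [proj, LinearMap.comp_apply, LinearEquiv.coe_coe, h, DirectSum.toModule_lof]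

theorem proj_of_mem {S : Set ℤ} {k : ℤ} (hk : k ∈ S) {X : g} (hX : X ∈ 𝒢 k) :
    proj 𝒢 S X = X := by
  rw [proj_apply_of_mem S hX, if_pos hk]
  rfl

theorem proj_of_notMem {S : Set ℤ} {k : ℤ} (hk : k ∉ S) {X : g} (hX : X ∈ 𝒢 k) :
    proj 𝒢 S X = 0 := by
  rw [proj_apply_of_mem S hX, if_neg hk]
  rfl

theorem projZero_of_mem {X : g} (hX : X ∈ 𝒢 0) : projZero 𝒢 X = X :=
  DirectSum.decompose_of_mem_same 𝒢 hX

theorem projZero_of_mem_ne {k : ℤ} (hk : k ≠ 0) {X : g} (hX : X ∈ 𝒢 k) : projZero 𝒢 X = 0 :=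
  DirectSum.decompose_of_mem_ne 𝒢 hX hk

variable (𝒢) in
theorem grade_hom_ext {M : Type*} [AddCommGroup M] [Module ℝ M] {f f' : g →ₗ[ℝ] M}
    (h : ∀ k, ∀ X ∈ 𝒢 k, f X = f' X) : f = f' := by
  ext X
  induction X using DirectSum.Decomposition.inductionOn 𝒢 with
  | zero => simp
  | @homogeneous i y => exact h i y y.2
  | add y y' h h' => rw [map_add, map_add, h, h']

theorem mem_nil_of_mem {k : ℤ} (hk : 0 < k) {X : g} (hX : X ∈ 𝒢 k) : X ∈ nil 𝒢 :=
  (Submodule.mem_iSup_of_mem (p := fun k : {k : ℤ // 0 < k} => 𝒢 k) ⟨k, hk⟩ hX :)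

theorem nil_hom_ext {M : Type*} [AddCommGroup M] [Module ℝ M] {f f' : g →ₗ[ℝ] M}
    (h : ∀ k, 0 < k → ∀ X ∈ 𝒢 k, f X = f' X) {X : g} (hX : X ∈ nil 𝒢) : f X = f' X := by
  change X ∈ ⨆ k : {k : ℤ // 0 < k}, 𝒢 k at hX
  induction hX using Submodule.iSup_induction' with
  | mem j y hy => exact h j j.2 y hy
  | zero => simp
  | add y y' _ _ h h' => rw [map_add, map_add, h, h']

variable (𝒢) in
/-- The projection onto `𝔫`. -/
noncomputable abbrev projPos : Module.End ℝ g := proj 𝒢 (Set.Ioi 0)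

variable (𝒢) in
/-- The projection onto the opposite of `𝔫`. -/
noncomputable abbrev projNeg : Module.End ℝ g := proj 𝒢 (Set.Iio 0)

theorem projPos_mem (X : g) : projPos 𝒢 X ∈ nil 𝒢 := by
  induction X using DirectSum.Decomposition.inductionOn 𝒢 with
  | zero => simp
  | @homogeneous i y =>
    by_cases hi : i ∈ Set.Ioi (0 : ℤ)
    · rw [proj_of_mem hi y.2]
      exact mem_nil_of_mem hi y.2
    · rw [proj_of_notMem hi y.2]
      exact zero_mem _
  | add y y' h h' => rw [map_add]; exact add_mem h h'

theorem projPos_of_mem {X : g} (hX : X ∈ nil 𝒢) : projPos 𝒢 X = X :=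
  nil_hom_ext (f := projPos 𝒢) (f' := LinearMap.id) (fun _ hk _ hY => proj_of_mem hk hY) hX

theorem projPos_of_mem_zero {X : g} (hX : X ∈ 𝒢 0) : projPos 𝒢 X = 0 :=
  proj_of_notMem (by simp) hX

theorem projZero_of_mem_nil {X : g} (hX : X ∈ nil 𝒢) : projZero 𝒢 X = 0 :=
  nil_hom_ext (f := projZero 𝒢) (f' := 0) (fun _ hk _ hY => projZero_of_mem_ne hk.ne' hY) hX

theorem projPos_add_projZero_add_projNeg :
    projPos 𝒢 + projZero 𝒢 + projNeg 𝒢 = 1 := by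
  refine grade_hom_ext 𝒢 fun k X hX => ?_
  rw [LinearMap.add_apply, LinearMap.add_apply, Module.End.one_apply]
  rcases lt_trichotomy 0 k with h | h | h
  · rw [proj_of_mem (Set.mem_Ioi.2 h) hX, projZero_of_mem_ne h.ne' hX,
      proj_of_notMem (by simp [h.le]) hX]
    simp
  · subst h
    rw [proj_of_notMem (by simp) hX, projZero_of_mem hX, proj_of_notMem (by simp) hX]
    simp
  · rw [proj_of_notMem (by simp [h.le]) hX, projZero_of_mem_ne h.ne hX,
      proj_of_mem (Set.mem_Iio.2 h) hX]
    simp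

theorem projPos_mul_ad_mul_projPos {Y : g} (hY : Y ∈ nil 𝒢) :
    projPos 𝒢 * LieAlgebra.ad ℝ g Y * projPos 𝒢 = LieAlgebra.ad ℝ g Y * projPos 𝒢 := by
  ext X
  exact projPos_of_mem ((nil 𝒢).lie_mem hY (projPos_mem X))

theorem projPos_mul_ad_mul_compl {Y : g} (hY : Y ∈ nil 𝒢) :
    projPos 𝒢 * LieAlgebra.ad ℝ g Y * (1 - projNeg 𝒢) =
      LieAlgebra.ad ℝ g Y * (1 - projNeg 𝒢) := by
  refine grade_hom_ext 𝒢 fun l X hX => ?_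
  simp only [Module.End.mul_apply, LinearMap.sub_apply, Module.End.one_apply,
    LieAlgebra.ad_apply]
  by_cases hl : l ∈ Set.Iio (0 : ℤ)
  · rw [proj_of_mem hl hX]
    simp
  · rw [proj_of_notMem hl hX, sub_zero]
    refine projPos_of_mem ?_
    rw [← lie_skew]
    -- Membership in `𝔫` becomes the vanishing of a linear map to the quotient by `𝔫`, which can be
    -- tested on homogeneous elements.
    refine neg_mem ((Submodule.Quotient.mk_eq_zero (nil 𝒢).toSubmodule).1 ?_)
    exact nil_hom_ext (𝒢 := 𝒢) (f := (nil 𝒢).toSubmodule.mkQ ∘ₗ LieAlgebra.ad ℝ g X)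
      (f' := 0) (fun k hk Y hY => (Submodule.Quotient.mk_eq_zero _).2
        (mem_nil_of_mem (k := l + k) (by rw [Set.mem_Iio] at hl; lia)
          (SetLike.GradedBracket.bracket_mem (ℒ := 𝒢) hX hY))) hY

end proj

variable {𝒢 : ℤ → Submodule ℝ g} [GradedLieAlgebra 𝒢] {σ : g ≃ₗ⁅ℝ⁆ g} {Z : g}

omit [GradedLieAlgebra 𝒢] in
theorem map_mem_grade (hrev : IsGradeReversing 𝒢 σ) {k : ℤ} {X : g} (hX : X ∈ 𝒢 k) :
    σ X ∈ 𝒢 (-k) := by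
  rw [← hrev k]
  exact ⟨X, hX, rfl⟩

theorem map_projPos (hrev : IsGradeReversing 𝒢 σ) (X : g) :
    σ (projPos 𝒢 X) = projNeg 𝒢 (σ X) := by
  have := grade_hom_ext 𝒢 (f := (σ : g →ₗ[ℝ] g) ∘ₗ projPos 𝒢) (f' := projNeg 𝒢 ∘ₗ (σ : g →ₗ[ℝ] g))
    fun k X hX => by
      change σ (projPos 𝒢 X) = projNeg 𝒢 (σ X)
      by_cases hk : k ∈ Set.Ioi (0 : ℤ)
      · rw [proj_of_mem hk hX, proj_of_mem (by simpa using hk) (map_mem_grade hrev hX)]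
      · rw [proj_of_notMem hk hX, proj_of_notMem (by simpa using hk) (map_mem_grade hrev hX),
          map_zero]
  exact LinearMap.congr_fun this X

omit [GradedLieAlgebra 𝒢] in
theorem characteristicElement_mem (hZ : IsCharacteristicElement 𝒢 Z) : Z ∈ 𝒢 0 := by
  rw [hZ]
  simp

theorem ad_mul_proj {U : g} (hU : U ∈ 𝒢 0) (S : Set ℤ) :
    LieAlgebra.ad ℝ g U * proj 𝒢 S = proj 𝒢 S * LieAlgebra.ad ℝ g U := by
  refine grade_hom_ext 𝒢 fun k X hX => ?_
  simp only [Module.End.mul_apply, LieAlgebra.ad_apply]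
  have h : ⁅U, X⁆ ∈ 𝒢 k := by simpa using SetLike.GradedBracket.bracket_mem (ℒ := 𝒢) hU hX
  by_cases hk : k ∈ S
  · rw [proj_of_mem hk hX, proj_of_mem hk h]
  · rw [proj_of_notMem hk hX, proj_of_notMem hk h, lie_zero]

theorem cartanInner_form (hσ : IsCartanInvolution σ) (X Y : g) :
    (cartanInner hσ).form X Y = -killingForm ℝ g X (σ Y) := rfl

omit [GradedLieAlgebra 𝒢] in
/-- Distinct graded components are orthogonal with respect to `B_σ`. -/
theorem cartanInner_eq_zero (hσ : IsCartanInvolution σ) (hrev : IsGradeReversing 𝒢 σ)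
    (hZ : IsCharacteristicElement 𝒢 Z) {k l : ℤ} (hkl : k ≠ l) {X Y : g} (hX : X ∈ 𝒢 k)
    (hY : Y ∈ 𝒢 l) : (cartanInner hσ).form X Y = 0 := by
  rw [cartanInner_form, neg_eq_zero]
  -- Invariance of the Killing form under `ad_Z`: as `σ Y` has degree `-l`, this gives `(k - l) B(X,
  -- σ Y) = 0`.
  have h1 : killingForm ℝ g ⁅Z, X⁆ (σ Y) = killingForm ℝ g X ⁅σ Y, Z⁆ := by
    rw [← lie_skew, map_neg, LinearMap.neg_apply, LieModule.traceForm_apply_lie_apply,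
      ← lie_skew, map_neg, neg_neg]
  rw [← lie_skew (σ Y) Z, (hZ _ _).1 (map_mem_grade hrev hY), (hZ k X).1 hX] at h1
  simp only [map_neg, map_smul, LinearMap.smul_apply, smul_eq_mul, Int.cast_neg] at h1
  have h2 : ((k : ℝ) - l) * killingForm ℝ g X (σ Y) = 0 := by linarith
  refine (mul_eq_zero.1 h2).resolve_left ?_
  rw [sub_eq_zero]
  exact_mod_cast hkl

theorem isAdjointPair_proj (hσ : IsCartanInvolution σ) (hrev : IsGradeReversing 𝒢 σ)
    (hZ : IsCharacteristicElement 𝒢 Z) (S : Set ℤ) :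
    (cartanInner hσ).form.IsAdjointPair (cartanInner hσ).form (proj 𝒢 S) (proj 𝒢 S) := by
  intro X Y
  suffices (cartanInner hσ).form ∘ₗ proj 𝒢 S = (cartanInner hσ).form.compl₂ (proj 𝒢 S) from
    LinearMap.congr_fun₂ this X Y
  refine grade_hom_ext 𝒢 fun k X hX => grade_hom_ext 𝒢 fun l Y hY => ?_
  change (cartanInner hσ).form (proj 𝒢 S X) Y = (cartanInner hσ).form X (proj 𝒢 S Y)
  by_cases hkl : k = l
  · subst hkl
    by_cases hk : k ∈ S
    · rw [proj_of_mem hk hX, proj_of_mem hk hY]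
    · rw [proj_of_notMem hk hX, proj_of_notMem hk hY]
      simp
  · have h := cartanInner_eq_zero hσ hrev hZ hkl hX hY
    have h1 : (cartanInner hσ).form (proj 𝒢 S X) Y = 0 := by
      by_cases hk : k ∈ S
      · rw [proj_of_mem hk hX, h]
      · rw [proj_of_notMem hk hX]; simp
    have h2 : (cartanInner hσ).form X (proj 𝒢 S Y) = 0 := by
      by_cases hk : l ∈ S
      · rw [proj_of_mem hk hY, h]
      · rw [proj_of_notMem hk hY]; simp
    rw [h1, h2]

theorem isAdjointPair_ad (hσ : IsCartanInvolution σ) (X : g) :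
    (cartanInner hσ).form.IsAdjointPair (cartanInner hσ).form (LieAlgebra.ad ℝ g X)
      (-LieAlgebra.ad ℝ g (σ X) : Module.End ℝ g) := by
  intro U V
  rw [LinearMap.neg_apply, LieAlgebra.ad_apply, LieAlgebra.ad_apply, cartanInner_form,
    cartanInner_form, map_neg, LieEquiv.map_lie, hσ.invol, ← lie_skew, map_neg, LinearMap.neg_apply,
    LieModule.traceForm_apply_lie_apply, map_neg]

theorem isAdjointPair_sigma (hσ : IsCartanInvolution σ) :
    (cartanInner hσ).form.IsAdjointPair (cartanInner hσ).form
      (σ : g →ₗ[ℝ] g) (σ : g →ₗ[ℝ] g) := by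
  intro U V
  change -killingForm ℝ g (σ U) (σ V) = -killingForm ℝ g U (σ (σ V))
  rw [LieAlgebra.killingForm_of_equiv_apply, hσ.invol]

end GradedLie

/-! ### The mean curvature vector and the Ricci curvature of `𝔫` -/

namespace GradedLie

variable {g : Type*} [LieRing g] [LieAlgebra ℝ g]
variable {𝒢 : ℤ → Submodule ℝ g} [GradedLieAlgebra 𝒢] {σ : g ≃ₗ⁅ℝ⁆ g} {Z : g}

theorem projPos_mul_projPos : projPos 𝒢 * projPos 𝒢 = projPos 𝒢 := by
  ext X
  exact projPos_of_mem (projPos_mem X)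

/-- The adjoint of `projPos_mul_ad_mul_projPos`, because `ad_Y` has adjoint `-ad_{σY}` and the
projection is self-adjoint. -/
theorem projPos_mul_ad_map (hσ : IsCartanInvolution σ) (hrev : IsGradeReversing 𝒢 σ)
    (hZ : IsCharacteristicElement 𝒢 Z) {Y : g} (hY : Y ∈ nil 𝒢) :
    projPos 𝒢 * LieAlgebra.ad ℝ g (σ Y) * projPos 𝒢 = projPos 𝒢 * LieAlgebra.ad ℝ g (σ Y) := by
  have hp := isAdjointPair_proj hσ hrev hZ (Set.Ioi 0)
  have hA := isAdjointPair_ad hσ (σ Y)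
  rw [hσ.invol] at hA
  have h1 := (hp.mul hA).mul hp
  have h2 := hp.mul hA
  ext X
  refine (cartanInner hσ).ext_form fun V => ?_
  rw [h1, h2, neg_mul, mul_neg, ← mul_assoc, projPos_mul_ad_mul_projPos hY]

theorem ad_lie (X Y : g) : LieAlgebra.ad ℝ g ⁅X, Y⁆ =
    LieAlgebra.ad ℝ g X * LieAlgebra.ad ℝ g Y - LieAlgebra.ad ℝ g Y * LieAlgebra.ad ℝ g X := by
  ext V
  simp

variable [Module.Finite ℝ g]

omit [Module.Finite ℝ g] in
-- For homogeneous `Y`, `W` the operator has weight `k + l > 0` under commutation with `ad_Z`, so a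
-- nonzero multiple of it is a commutator.
theorem trace_ad_mul_ad_mul_projPos (hZ : IsCharacteristicElement 𝒢 Z) {Y W : g}
    (hY : Y ∈ nil 𝒢) (hW : W ∈ nil 𝒢) :
    LinearMap.trace ℝ g (LieAlgebra.ad ℝ g Y * LieAlgebra.ad ℝ g W * projPos 𝒢) = 0 := by
  refine nil_hom_ext (𝒢 := 𝒢)
    (f := LinearMap.trace ℝ g ∘ₗ LinearMap.mulRight ℝ (LieAlgebra.ad ℝ g W * projPos 𝒢) ∘ₗ
      (LieAlgebra.ad ℝ g : g →ₗ[ℝ] Module.End ℝ g)) (f' := 0) (fun k hk Y hY => ?_) hY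
  refine nil_hom_ext (𝒢 := 𝒢)
    (f := LinearMap.trace ℝ g ∘ₗ LinearMap.mulLeft ℝ (LieAlgebra.ad ℝ g Y) ∘ₗ
      LinearMap.mulRight ℝ (projPos 𝒢) ∘ₗ
      (LieAlgebra.ad ℝ g : g →ₗ[ℝ] Module.End ℝ g)) (f' := 0) (fun l hl W hW => ?_) hW
  change LinearMap.trace ℝ g (LieAlgebra.ad ℝ g Y * (LieAlgebra.ad ℝ g W * projPos 𝒢)) = 0
  have hp := ad_mul_proj (characteristicElement_mem hZ) (Set.Ioi 0)
  have h1 {m : ℤ} {X : g} (hX : X ∈ 𝒢 m) : LieAlgebra.ad ℝ g Z * LieAlgebra.ad ℝ g X -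
      LieAlgebra.ad ℝ g X * LieAlgebra.ad ℝ g Z = (m : ℝ) • LieAlgebra.ad ℝ g X := by
    rw [← map_smul, ← (hZ m X).1 hX, ad_lie]
  have h2 : ((k : ℝ) + l) • (LieAlgebra.ad ℝ g Y * (LieAlgebra.ad ℝ g W * projPos 𝒢)) =
      LieAlgebra.ad ℝ g Z * (LieAlgebra.ad ℝ g Y * (LieAlgebra.ad ℝ g W * projPos 𝒢)) -
      (LieAlgebra.ad ℝ g Y * (LieAlgebra.ad ℝ g W * projPos 𝒢)) * LieAlgebra.ad ℝ g Z := by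
    rw [add_smul, ← smul_mul_assoc, ← h1 hY, ← mul_smul_comm (l : ℝ), ← smul_mul_assoc, ← h1 hW]
    simp only [sub_mul, mul_sub, mul_assoc, hp]
    abel
  have h3 := congrArg (LinearMap.trace ℝ g) h2
  rw [map_sub, LinearMap.trace_mul_comm ℝ (LieAlgebra.ad ℝ g Z), sub_self, map_smul] at h3
  refine (smul_eq_zero.1 h3).resolve_left ?_
  have : (0 : ℝ) < k := by exact_mod_cast hk
  have : (0 : ℝ) < l := by exact_mod_cast hl
  positivity

variable (𝒢) in
/-- The functional `X ↦ tr(ad_X|𝔫)`. -/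
noncomputable def traceNil : Module.Dual ℝ g :=
  LinearMap.trace ℝ g ∘ₗ LinearMap.mulRight ℝ (projPos 𝒢) ∘ₗ
    (LieAlgebra.ad ℝ g : g →ₗ[ℝ] Module.End ℝ g)

omit [Module.Finite ℝ g] in
theorem traceNil_apply (X : g) :
    traceNil 𝒢 X = LinearMap.trace ℝ g (LieAlgebra.ad ℝ g X * projPos 𝒢) := rfl

theorem traceNil_map (hσ : IsCartanInvolution σ) (hrev : IsGradeReversing 𝒢 σ)
    (hZ : IsCharacteristicElement 𝒢 Z) (X : g) : traceNil 𝒢 (σ X) = -traceNil 𝒢 X := by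
  rw [traceNil_apply, traceNil_apply, (cartanInner hσ).trace_eq_of_isAdjointPair
    ((isAdjointPair_ad hσ X).mul (isAdjointPair_proj hσ hrev hZ (Set.Ioi 0))), mul_neg, map_neg,
    neg_neg, LinearMap.trace_mul_comm]

omit [Module.Finite ℝ g] in
-- As `ad_U` commutes with the projection onto `𝔫`, the operator under the trace is a commutator.
theorem traceNil_lie {U : g} (hU : U ∈ 𝒢 0) (X : g) : traceNil 𝒢 ⁅U, X⁆ = 0 := by
  rw [traceNil_apply, ad_lie, sub_mul, map_sub, mul_assoc, mul_assoc,
    ad_mul_proj hU, LinearMap.trace_mul_comm ℝ (LieAlgebra.ad ℝ g U), mul_assoc, sub_self]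

variable (𝒢) in
/-- The vector which represents `X ↦ tr(ad_X|𝔫)` with respect to `B_σ`. -/
noncomputable def nilVector (hσ : IsCartanInvolution σ) : g :=
  (cartanInner hσ).riesz (traceNil 𝒢)

theorem cartanInner_nilVector (hσ : IsCartanInvolution σ) (X : g) :
    (cartanInner hσ).form (nilVector 𝒢 hσ) X = traceNil 𝒢 X :=
  (cartanInner hσ).form_riesz _ _

theorem map_nilVector (hσ : IsCartanInvolution σ) (hrev : IsGradeReversing 𝒢 σ)
    (hZ : IsCharacteristicElement 𝒢 Z) : σ (nilVector 𝒢 hσ) = -nilVector 𝒢 hσ := by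
  refine (cartanInner hσ).ext_form fun X => ?_
  refine (isAdjointPair_sigma hσ _ X).trans ?_
  change (cartanInner hσ).form (nilVector 𝒢 hσ) (σ X) = _
  rw [cartanInner_nilVector, traceNil_map hσ hrev hZ, map_neg, LinearMap.neg_apply,
    cartanInner_nilVector]

/-- Dual to `traceNil_lie`. Taking `U = Z` places the vector in `𝔤_0`, taking `U ∈ 𝔞` lets
maximality place it in `𝔞`, and in general it makes every multiple of `H₀` central in `𝔤_0`. -/
theorem lie_nilVector (hσ : IsCartanInvolution σ) (hrev : IsGradeReversing 𝒢 σ)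
    {U : g} (hU : U ∈ 𝒢 0) : ⁅U, nilVector 𝒢 hσ⁆ = 0 := by
  refine (cartanInner hσ).ext_form fun X => ?_
  refine (isAdjointPair_ad hσ U _ X).trans ?_
  rw [LinearMap.neg_apply, map_neg, cartanInner_nilVector, LieAlgebra.ad_apply,
    traceNil_lie (by simpa using map_mem_grade hrev hU)]
  simp

theorem nilVector_mem_grade_zero (hσ : IsCartanInvolution σ) (hrev : IsGradeReversing 𝒢 σ)
    (hZ : IsCharacteristicElement 𝒢 Z) : nilVector 𝒢 hσ ∈ 𝒢 0 := by
  rw [hZ, lie_nilVector hσ hrev (characteristicElement_mem hZ)]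
  simp

omit [Module.Finite ℝ g] in
theorem cartanInner_grade_zero_nil (hσ : IsCartanInvolution σ) (hrev : IsGradeReversing 𝒢 σ)
    (hZ : IsCharacteristicElement 𝒢 Z) {X U : g} (hX : X ∈ 𝒢 0) (hU : U ∈ nil 𝒢) :
    (cartanInner hσ).form X U = 0 :=
  nil_hom_ext (f := (cartanInner hσ).form X) (f' := 0)
    (fun _ hk _ hY => cartanInner_eq_zero hσ hrev hZ hk.ne hX hY) hU

theorem traceNil_of_mem_nil (hσ : IsCartanInvolution σ) (hrev : IsGradeReversing 𝒢 σ)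
    (hZ : IsCharacteristicElement 𝒢 Z) {U : g} (hU : U ∈ nil 𝒢) : traceNil 𝒢 U = 0 := by
  rw [← cartanInner_nilVector hσ,
    cartanInner_grade_zero_nil hσ hrev hZ (nilVector_mem_grade_zero hσ hrev hZ) hU]

omit [GradedLieAlgebra 𝒢] [Module.Finite ℝ g] in
theorem form_lie_of_mem_pSpace (hσ : IsCartanInvolution σ) {T : g} (hT : T ∈ pSpace σ)
    (X Y : g) : (cartanInner hσ).form ⁅T, X⁆ Y = (cartanInner hσ).form X ⁅T, Y⁆ := by
  have h : σ T = -T := hT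
  refine (isAdjointPair_ad hσ T X Y).trans ?_
  rw [h, map_neg, neg_neg, LieAlgebra.ad_apply]

/-- Twice the endomorphism `U ↦ -∇_U Y` of `𝔫`, extended by zero to `𝔤`. -/
noncomputable def nilDeriv (𝒢 : ℤ → Submodule ℝ g) [GradedLieAlgebra 𝒢] (σ : g ≃ₗ⁅ℝ⁆ g) (Y : g) :
    Module.End ℝ g :=
  projPos 𝒢 * (LieAlgebra.ad ℝ g Y - LieAlgebra.ad ℝ g (σ Y) +
    LieAlgebra.ad ℝ g Y * (σ : g →ₗ[ℝ] g)) * projPos 𝒢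

omit [Module.Finite ℝ g] in
theorem nilDeriv_apply_eq (Y V : g) :
    nilDeriv 𝒢 σ Y V = projPos 𝒢 (nilDeriv 𝒢 σ Y (projPos 𝒢 V)) := by
  have : nilDeriv 𝒢 σ Y = projPos 𝒢 * (nilDeriv 𝒢 σ Y * projPos 𝒢) := by
    rw [nilDeriv, mul_assoc _ (projPos 𝒢) (projPos 𝒢), projPos_mul_projPos, ← mul_assoc,
      ← mul_assoc, projPos_mul_projPos]
  conv_lhs => rw [this]
  rfl

omit [Module.Finite ℝ g] in
-- The right-hand side is Koszul's expression for `-2⟨∇_U Y, V⟩`. Its second and third terms turn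
-- into `-ad_{σY}` and `ad_Y σ` when the bracket is moved across `B_σ`.
theorem form_nilDeriv (hσ : IsCartanInvolution σ) (hrev : IsGradeReversing 𝒢 σ)
    (hZ : IsCharacteristicElement 𝒢 Z) (Y : g) {U V : g} (hU : U ∈ nil 𝒢) (hV : V ∈ nil 𝒢) :
    (cartanInner hσ).form (nilDeriv 𝒢 σ Y U) V = (cartanInner hσ).form ⁅Y, U⁆ V +
      (cartanInner hσ).form ⁅Y, V⁆ U + (cartanInner hσ).form ⁅U, V⁆ Y := by
  have h : nilDeriv 𝒢 σ Y U = projPos 𝒢 (⁅Y, U⁆ - ⁅σ Y, U⁆ + ⁅Y, σ U⁆) := by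
    rw [nilDeriv, Module.End.mul_apply, projPos_of_mem hU]
    rfl
  have h1 := isAdjointPair_ad hσ (σ Y) U V
  have h2 := isAdjointPair_ad hσ (σ U) Y V
  rw [hσ.invol, LinearMap.neg_apply, map_neg] at h1 h2
  simp only [LieAlgebra.ad_apply] at h1 h2
  rw [h, isAdjointPair_proj hσ hrev hZ, projPos_of_mem hV, map_add, map_sub, LinearMap.add_apply,
    LinearMap.sub_apply, h1, ← lie_skew Y (σ U), map_neg, LinearMap.neg_apply, h2,
    (cartanInner hσ).symm U, (cartanInner hσ).symm Y]
  ring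

/-- The Ricci curvature of `𝔫` is `1/2 ad_{H₀} - 1/4`. -/
theorem trace_nilDeriv_mul_nilDeriv (hσ : IsCartanInvolution σ) (hrev : IsGradeReversing 𝒢 σ)
    (hZ : IsCharacteristicElement 𝒢 Z) {Y W : g} (hY : Y ∈ nil 𝒢) (hW : W ∈ nil 𝒢) :
    LinearMap.trace ℝ g (nilDeriv 𝒢 σ Y * nilDeriv 𝒢 σ W) = (cartanInner hσ).form Y W -
      2 * (cartanInner hσ).form ⁅nilVector 𝒢 hσ, Y⁆ W := by
  have hAC := trace_ad_mul_ad_mul_projPos hZ hY hW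
  have hCA := trace_ad_mul_ad_mul_projPos hZ hW hY
  have pA := projPos_mul_ad_mul_projPos hY
  have pC := projPos_mul_ad_mul_projPos hW
  have pA' := projPos_mul_ad_map hσ hrev hZ hY
  have pC' := projPos_mul_ad_map hσ hrev hZ hW
  have nC := projPos_mul_ad_mul_compl hW
  have aA := isAdjointPair_ad hσ Y
  have aC := isAdjointPair_ad hσ W
  have aA' := isAdjointPair_ad hσ (σ Y)
  have aC' := isAdjointPair_ad hσ (σ W)
  have ap : (cartanInner hσ).form.IsAdjointPair (cartanInner hσ).form (projPos 𝒢) (projPos 𝒢) :=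
    isAdjointPair_proj hσ hrev hZ _
  have an : (cartanInner hσ).form.IsAdjointPair (cartanInner hσ).form (projNeg 𝒢) (projNeg 𝒢) :=
    isAdjointPair_proj hσ hrev hZ _
  have as := isAdjointPair_sigma hσ
  have pp := projPos_mul_projPos (𝒢 := 𝒢)
  have hkill : LinearMap.trace ℝ g (LieAlgebra.ad ℝ g (σ W) * LieAlgebra.ad ℝ g Y) =
      -(cartanInner hσ).form Y W := by
    rw [LinearMap.trace_mul_comm, cartanInner_form, neg_neg, killingForm_apply_apply]
    rfl
  have hvec : LinearMap.trace ℝ g (LieAlgebra.ad ℝ g (σ W) * LieAlgebra.ad ℝ g Y * projPos 𝒢) -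
      LinearMap.trace ℝ g (LieAlgebra.ad ℝ g Y * LieAlgebra.ad ℝ g (σ W) * projPos 𝒢) =
      (cartanInner hσ).form ⁅nilVector 𝒢 hσ, Y⁆ W := by
    rw [← map_sub, ← sub_mul, ← ad_lie, ← traceNil_apply,
      ← cartanInner_nilVector hσ, form_lie_of_mem_pSpace hσ (map_nilVector hσ hrev hZ),
      ← lie_skew _ W, map_neg, (cartanInner hσ).symm Y, ← LieAlgebra.ad_apply ℝ g W, aC,
      LinearMap.neg_apply, map_neg, neg_neg, LieAlgebra.ad_apply]
  have ss : (σ : g →ₗ[ℝ] g) * (σ : g →ₗ[ℝ] g) = (1 : Module.End ℝ g) := by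
    ext X
    exact hσ.invol X
  have sA (X : g) : (σ : g →ₗ[ℝ] g) * LieAlgebra.ad ℝ g X =
      LieAlgebra.ad ℝ g (σ X) * (σ : g →ₗ[ℝ] g) := by
    ext V
    exact LieEquiv.map_lie σ X V
  have sA' (X : g) : (σ : g →ₗ[ℝ] g) * LieAlgebra.ad ℝ g (σ X) =
      LieAlgebra.ad ℝ g X * (σ : g →ₗ[ℝ] g) := by
    rw [sA, hσ.invol]
  have sp : (σ : g →ₗ[ℝ] g) * projPos 𝒢 = projNeg 𝒢 * (σ : g →ₗ[ℝ] g) := by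
    ext X
    exact map_projPos hrev X
  have sA1 := sA Y
  have sC1 := sA W
  have sA2 := sA' Y
  have sC2 := sA' W
  rw [nilDeriv, nilDeriv]
  rw [hσ.invol] at aA' aC'
  -- From here on the argument is noncommutative algebra in the letters `p`, `n`, `A`, `C`, `A'`,
  -- `C'` and later `s = σ`. The recorded relations and adjoints are all that is needed.
  generalize projPos 𝒢 = p at *
  generalize projNeg 𝒢 = n at *
  generalize LieAlgebra.ad ℝ g Y = A at *
  generalize LieAlgebra.ad ℝ g W = C at *
  generalize LieAlgebra.ad ℝ g (σ Y) = A' at *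
  generalize LieAlgebra.ad ℝ g (σ W) = C' at *
  have hS : p * (A - A' + A * (σ : g →ₗ[ℝ] g)) * p = (A * p - p * A') +
      p * (A * (σ : g →ₗ[ℝ] g)) * p := by
    rw [mul_add, add_mul, mul_sub, sub_mul, pA, pA']
  have hS' : p * (C - C' + C * (σ : g →ₗ[ℝ] g)) * p = (C * p - p * C') +
      p * (C * (σ : g →ₗ[ℝ] g)) * p := by
    rw [mul_add, add_mul, mul_sub, sub_mul, pC, pC']
  rw [hS, hS']
  generalize (σ : g →ₗ[ℝ] g) = s at *
  -- The trace of a symmetric operator times a skew one is zero. This leaves only symmetric times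
  -- symmetric (`hSS`) and skew times skew (`hKK`).
  have hcross {f k : Module.End ℝ g}
      (hf : (cartanInner hσ).form.IsAdjointPair (cartanInner hσ).form f f)
      (hk : (cartanInner hσ).form.IsAdjointPair (cartanInner hσ).form k (-k : Module.End ℝ g)) :
      LinearMap.trace ℝ g (f * k) = 0 := by
    have h := (cartanInner hσ).trace_eq_of_isAdjointPair (hf.mul hk)
    rw [neg_mul, map_neg, LinearMap.trace_mul_comm ℝ k] at h
    linarith
  have hsym {D D' : Module.End ℝ g}
      (hD : (cartanInner hσ).form.IsAdjointPair (cartanInner hσ).form D (-D' : Module.End ℝ g))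
      (hD' : (cartanInner hσ).form.IsAdjointPair (cartanInner hσ).form D' (-D : Module.End ℝ g)) :
      (cartanInner hσ).form.IsAdjointPair (cartanInner hσ).form (D * p - p * D' : Module.End ℝ g)
        (D * p - p * D' : Module.End ℝ g) := by
    intro x y
    rw [LinearMap.sub_apply, map_sub, LinearMap.sub_apply, hD.mul ap x y, ap.mul hD' x y,
      ← map_sub, ← LinearMap.sub_apply, neg_mul, mul_neg, neg_sub_neg]
  have hskew {D D' : Module.End ℝ g}
      (hD : (cartanInner hσ).form.IsAdjointPair (cartanInner hσ).form D (-D' : Module.End ℝ g))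
      (sD : s * D' = D * s) :
      (cartanInner hσ).form.IsAdjointPair (cartanInner hσ).form (p * (D * s) * p : Module.End ℝ g)
        (-(p * (D * s) * p) : Module.End ℝ g) := by
    have h := (ap.mul (hD.mul as)).mul ap
    rwa [mul_neg, sD, neg_mul, mul_neg, ← mul_assoc] at h
  have hSK := hcross (hsym aA aA') (hskew aC sC2)
  have hKS := hcross (hsym aC aC') (hskew aA sA2)
  rw [LinearMap.trace_mul_comm] at hKS
  have conj (f : Module.End ℝ g) :
      LinearMap.trace ℝ g (s * f * s) = LinearMap.trace ℝ g f := by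
    rw [LinearMap.trace_mul_comm, ← mul_assoc, ss, one_mul]
  have hu : LinearMap.trace ℝ g (p * A' * C) = LinearMap.trace ℝ g (C' * A * p) := by
    rw [(cartanInner hσ).trace_eq_of_isAdjointPair ((ap.mul aA').mul aC), neg_mul, neg_mul,
      mul_neg, neg_neg, ← mul_assoc]
  -- The terms `A C p` and `p A' C'` are traceless: the first by weight, the second as the adjoint
  -- of such a term. The two mixed terms have equal traces.
  have hSS : LinearMap.trace ℝ g ((A * p - p * A') * (C * p - p * C')) =
      -2 * LinearMap.trace ℝ g (C' * A * p) := by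
    have e1 : (A * p - p * A') * (C * p - p * C') =
        A * C * p - A * p * C' - p * A' * C * p + p * A' * C' := by
      calc _ = A * (p * C * p) - A * (p * p) * C' - p * A' * C * p + p * A' * p * C' := by
            noncomm_ring
        _ = _ := by rw [pC, pp, pA']; noncomm_ring
    have e2 : LinearMap.trace ℝ g (A * p * C') = LinearMap.trace ℝ g (C' * A * p) := by
      rw [LinearMap.trace_mul_comm, mul_assoc]
    have e3 : LinearMap.trace ℝ g (p * A' * C * p) = LinearMap.trace ℝ g (C' * A * p) := by
      rw [LinearMap.trace_mul_comm, ← mul_assoc, ← mul_assoc, pp, hu]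
    have e4 : LinearMap.trace ℝ g (p * A' * C') = 0 := by
      rw [(cartanInner hσ).trace_eq_of_isAdjointPair ((ap.mul aA').mul aC'), neg_mul, neg_mul,
        mul_neg, neg_neg, ← mul_assoc, hCA]
    rw [e1, map_add, map_sub, map_sub, hAC, e2, e3, e4]
    ring
  have sn : s * n = p * s := by
    calc s * n = s * n * (s * s) := by rw [ss, mul_one]
      _ = s * (n * s) * s := by noncomm_ring
      _ = (s * s) * p * s := by rw [← sp]; noncomm_ring
      _ = p * s := by rw [ss, one_mul]
  have sp1 : s * (1 - p) = (1 - n) * s := by rw [mul_sub, sub_mul, sp, mul_one, one_mul]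
  -- Since `σ p σ = n`, the trace is that of `C' p A n`; splitting `p = 1 - (1 - p)` brings in the
  -- full trace of `C' A`, that is, the Killing form.
  have hKK : LinearMap.trace ℝ g (p * (A * s) * p * (p * (C * s) * p)) =
      2 * LinearMap.trace ℝ g (C' * A * n) - LinearMap.trace ℝ g (C' * A) := by
    -- The `σ`-conjugate of `nC`: `ad_{σW}` sends nonpositive degrees to negative ones.
    have nC' : n * C' * (1 - p) = C' * (1 - p) := by
      calc n * C' * (1 - p) = s * s * n * C' * (1 - p) := by rw [ss, one_mul]
        _ = s * (s * n) * C' * (1 - p) := by noncomm_ring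
        _ = s * p * (s * C') * (1 - p) := by rw [sn]; noncomm_ring
        _ = s * p * C * (s * (1 - p)) := by rw [sC2]; noncomm_ring
        _ = s * (p * C * (1 - n)) * s := by rw [sp1]; noncomm_ring
        _ = (s * C) * ((1 - n) * s) := by rw [nC]; noncomm_ring
        _ = C' * (s * s) * (1 - p) := by rw [sC1, ← sp1]; noncomm_ring
        _ = C' * (1 - p) := by rw [ss, mul_one]
    have e1 : LinearMap.trace ℝ g (p * (A * s) * p * (p * (C * s) * p)) =
        LinearMap.trace ℝ g (C' * p * A * n) := by
      calc _ = LinearMap.trace ℝ g (p * (A * (s * p) * C * s * p)) := by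
            congr 1
            calc _ = p * (A * s * (p * p) * C * s * p) := by noncomm_ring
              _ = _ := by rw [pp]; noncomm_ring
        _ = LinearMap.trace ℝ g (A * n * (s * C) * s * (p * p)) := by
            rw [LinearMap.trace_mul_comm, sp]; congr 1
        _ = LinearMap.trace ℝ g (A * n * (C' * (s * s) * p)) := by
            rw [pp, sC1]; congr 1
        _ = _ := by
            rw [ss, mul_one, LinearMap.trace_mul_comm]; congr 1
    have e2 : LinearMap.trace ℝ g (C' * (1 - p) * A * n) =
        LinearMap.trace ℝ g (C' * A * (1 - n)) := by
      calc _ = LinearMap.trace ℝ g (n * C' * (1 - p) * A) := by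
            rw [LinearMap.trace_mul_comm]; congr 1
        _ = LinearMap.trace ℝ g (s * (C' * (1 - p) * A) * s) := by rw [nC', conj]
        _ = LinearMap.trace ℝ g (C * (1 - n) * A') := by
            congr 1
            calc _ = (s * C') * (1 - p) * A * s := by noncomm_ring
              _ = C * (s - s * p) * A * s := by rw [sC2]; noncomm_ring
              _ = C * (1 - n) * (s * A) * s := by rw [sp]; noncomm_ring
              _ = C * (1 - n) * A' * (s * s) := by rw [sA1]; noncomm_ring
              _ = _ := by rw [ss, mul_one]
        _ = LinearMap.trace ℝ g (A * (1 - n) * C') := by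
            have h1n : (cartanInner hσ).form.IsAdjointPair (cartanInner hσ).form
                (1 - n : Module.End ℝ g) (1 - n : Module.End ℝ g) := by
              intro x y
              rw [LinearMap.sub_apply, map_sub, LinearMap.sub_apply, an, LinearMap.sub_apply,
                map_sub]
              rfl
            rw [(cartanInner hσ).trace_eq_of_isAdjointPair ((aC.mul h1n).mul aA'), neg_mul, mul_neg,
              mul_neg, neg_neg, ← mul_assoc]
        _ = _ := by
            rw [LinearMap.trace_mul_comm, ← mul_assoc]
    have e3 : C' * p * A * n = C' * A * n - C' * (1 - p) * A * n := by noncomm_ring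
    rw [e1, e3, map_sub, e2, mul_sub, mul_one, map_sub]
    ring
  have hn : LinearMap.trace ℝ g (C' * A * n) = LinearMap.trace ℝ g (A * C' * p) := by
    calc _ = LinearMap.trace ℝ g (s * (C' * A * n) * s) := (conj _).symm
      _ = LinearMap.trace ℝ g (C * A' * p) := by
          congr 1
          calc _ = (s * C') * A * n * s := by noncomm_ring
            _ = C * (s * A) * n * s := by rw [sC2]; noncomm_ring
            _ = C * A' * (s * n) * s := by rw [sA1]; noncomm_ring
            _ = C * A' * p * (s * s) := by rw [sn]; noncomm_ring
            _ = _ := by rw [ss, mul_one]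
      _ = LinearMap.trace ℝ g (p * (A * C')) := by
          rw [(cartanInner hσ).trace_eq_of_isAdjointPair ((aC.mul aA').mul ap), neg_mul, mul_neg,
            mul_neg, mul_neg, neg_neg]
      _ = _ := LinearMap.trace_mul_comm _ _ _
  rw [add_mul, mul_add, mul_add, map_add, map_add, map_add, hSS, hSK, hKS, hKK, hkill, hn, ← hvec]
  ring

end GradedLie

/-! ### The extensions `𝔞 + 𝔫` and `ℝH + 𝔫` -/

namespace GradedLie

variable {g : Type*} [LieRing g] [LieAlgebra ℝ g]
variable {𝒢 : ℤ → Submodule ℝ g} [GradedLieAlgebra 𝒢] {σ : g ≃ₗ⁅ℝ⁆ g} {Z : g}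

/-- The projection of `𝔤` onto `𝔫`, as a map into a subalgebra which contains `𝔫`. -/
noncomputable def nilProj {E : LieSubalgebra ℝ g} (hE : nil 𝒢 ≤ E) : g →ₗ[ℝ] E :=
  (projPos 𝒢).codRestrict E.toSubmodule fun X => hE (projPos_mem X)

theorem coe_nilProj {E : LieSubalgebra ℝ g} (hE : nil 𝒢 ≤ E) (X : g) :
    (nilProj hE X : g) = projPos 𝒢 X := rfl

theorem nilProj_coe {E : LieSubalgebra ℝ g} (hE : nil 𝒢 ≤ E) {x : E} (hx : (x : g) ∈ nil 𝒢) :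
    nilProj hE (x : g) = x :=
  Subtype.ext (projPos_of_mem hx)

theorem nilProj_projPos {E : LieSubalgebra ℝ g} (hE : nil 𝒢 ≤ E) (X : g) :
    nilProj hE (projPos 𝒢 X) = nilProj hE X :=
  Subtype.ext (projPos_of_mem (projPos_mem X))

/-- An operator with image in `𝔫` factors through the projection onto `𝔫`; cyclicity of the trace
then moves the computation from the subalgebra to `𝔤`. -/
theorem trace_eq_of_forall_mem_nil [Module.Finite ℝ g] {E : LieSubalgebra ℝ g} (hE : nil 𝒢 ≤ E)
    {f : Module.End ℝ E} (hf : ∀ x, (f x : g) ∈ nil 𝒢) :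
    LinearMap.trace ℝ E f =
      LinearMap.trace ℝ g (E.toSubmodule.subtype ∘ₗ f ∘ₗ nilProj hE) := by
  have h : f = nilProj hE ∘ₗ (E.toSubmodule.subtype ∘ₗ f) := by
    ext x : 1
    exact (nilProj_coe hE (hf x)).symm
  conv_lhs => rw [h]
  exact LinearMap.trace_comp_comm' (E.toSubmodule.subtype ∘ₗ f) (nilProj hE)

theorem trace_ad_eq_traceNil [Module.Finite ℝ g] {E : LieSubalgebra ℝ g} (hE : nil 𝒢 ≤ E)
    (hE' : ∀ x y : E, ((⁅x, y⁆ : E) : g) ∈ nil 𝒢) (x : E) :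
    LinearMap.trace ℝ E (LieAlgebra.ad ℝ E x) = traceNil 𝒢 (x : g) := by
  rw [trace_eq_of_forall_mem_nil hE (hE' x), traceNil_apply]
  rfl

section extension

variable {V : Submodule ℝ g} (hV : IsAbelianSubspace V) (hV0 : V ≤ 𝒢 0)

theorem nil_le_extension : nil 𝒢 ≤ extension V hV hV0 :=
  fun _ hX => Submodule.mem_sup_right hX

theorem lie_mem_nil_of_mem_extension (x y : extension V hV hV0) :
    ((⁅x, y⁆ : extension V hV hV0) : g) ∈ nil 𝒢 := by
  obtain ⟨X, hX⟩ := x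
  obtain ⟨Y, hY⟩ := y
  obtain ⟨A, hA, U, hU, rfl⟩ := Submodule.mem_sup.1 hX
  obtain ⟨A', hA', U', hU', rfl⟩ := Submodule.mem_sup.1 hY
  change ⁅A + U, A' + U'⁆ ∈ nil 𝒢
  rw [add_lie, lie_add, lie_add, hV A hA A' hA', zero_add, ← lie_skew U A']
  exact add_mem (lie_grade_zero_mem_nil 𝒢 (hV0 hA) hU')
    (add_mem (neg_mem (lie_grade_zero_mem_nil 𝒢 (hV0 hA') hU)) ((nil 𝒢).lie_mem hU hU'))

end extension

section meanCurvature

variable [Module.Finite ℝ g] {𝔞 : Submodule ℝ g}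

/-- The vector lies in `𝔭` and commutes with `𝔞 ⊆ 𝔤_0`, so adjoining it to `𝔞` keeps an abelian
subspace of `𝔭`; maximality applies. -/
theorem nilVector_mem (hσ : IsCartanInvolution σ) (hrev : IsGradeReversing 𝒢 σ)
    (hZ : IsCharacteristicElement 𝒢 Z) (h𝔞 : IsMaximalAbelian σ 𝔞) (hZ𝔞 : Z ∈ 𝔞) :
    nilVector 𝒢 hσ ∈ 𝔞 := by
  have comm : ∀ X ∈ 𝔞, ⁅X, nilVector 𝒢 hσ⁆ = 0 := fun X hX =>
    lie_nilVector hσ hrev (h𝔞.mem_grade_zero hZ hZ𝔞 hX)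
  refine h𝔞.le_of_ge (y := 𝔞 ⊔ Submodule.span ℝ {nilVector 𝒢 hσ}) ⟨?_, ?_⟩ le_sup_left
    (Submodule.mem_sup_right (Submodule.mem_span_singleton_self _))
  · refine sup_le h𝔞.prop.1 ?_
    rw [Submodule.span_singleton_le_iff_mem]
    exact map_nilVector hσ hrev hZ
  · intro X hX Y hY
    obtain ⟨A, hA, U, hU, rfl⟩ := Submodule.mem_sup.1 hX
    obtain ⟨A', hA', U', hU', rfl⟩ := Submodule.mem_sup.1 hY
    obtain ⟨r, rfl⟩ := Submodule.mem_span_singleton.1 hU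
    obtain ⟨r', rfl⟩ := Submodule.mem_span_singleton.1 hU'
    rw [add_lie, lie_add, lie_add, h𝔞.prop.2 A hA A' hA', ← lie_skew _ A', lie_smul, lie_smul,
      comm A hA, comm A' hA']
    simp

theorem meanCurvature_eq_nilVector (hσ : IsCartanInvolution σ) (hrev : IsGradeReversing 𝒢 σ)
    (hZ : IsCharacteristicElement 𝒢 Z) (h𝔞 : IsMaximalAbelian σ 𝔞) (hZ𝔞 : Z ∈ 𝔞) :
    meanCurvature hσ h𝔞.prop.2 (le_grade_zero hZ h𝔞.prop.2 hZ𝔞) = nilVector 𝒢 hσ := by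
  have h := eq_meanCurvatureVector
    (L := extension (𝒢 := 𝒢) 𝔞 h𝔞.prop.2 (le_grade_zero hZ h𝔞.prop.2 hZ𝔞)) ((cartanInner hσ).restrict
    (extension (𝒢 := 𝒢) 𝔞 h𝔞.prop.2 (le_grade_zero hZ h𝔞.prop.2 hZ𝔞)).toSubmodule)
    (h := ⟨nilVector 𝒢 hσ, Submodule.mem_sup_left (nilVector_mem hσ hrev hZ h𝔞 hZ𝔞)⟩)
    fun A => (cartanInner_nilVector hσ (A : g)).trans
      (trace_ad_eq_traceNil (nil_le_extension _ _) (lie_mem_nil_of_mem_extension _ _) A).symm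
  exact congrArg Subtype.val h

end meanCurvature

section line

variable {H : g} (hH : H ∈ 𝒢 0) (hσ : IsCartanInvolution σ) {c : ℝ} (hc : 0 < c)

theorem nil_le_lineExtension : nil 𝒢 ≤ lineExtension (𝒢 := 𝒢) hH :=
  nil_le_extension _ _

theorem lie_mem_nil_of_mem_lineExtension (x y : lineExtension (𝒢 := 𝒢) hH) :
    ((⁅x, y⁆ : lineExtension (𝒢 := 𝒢) hH) : g) ∈ nil 𝒢 :=
  lie_mem_nil_of_mem_extension _ _ x y

theorem exists_eq_smul_lineElement_add (x : lineExtension (𝒢 := 𝒢) hH) :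
    ∃ (t : ℝ) (u : lineExtension (𝒢 := 𝒢) hH), (u : g) ∈ nil 𝒢 ∧
      x = t • lineElement hH + u := by
  obtain ⟨X, hX⟩ := x
  obtain ⟨A, hA, U, hU, rfl⟩ := Submodule.mem_sup.1 hX
  obtain ⟨t, rfl⟩ := Submodule.mem_span_singleton.1 hA
  exact ⟨t, ⟨U, Submodule.mem_sup_right hU⟩, hU, rfl⟩

theorem lineInner_apply (x y : lineExtension (𝒢 := 𝒢) hH) :
    (lineInner hσ hH c hc).form x y =
      c * (cartanInner hσ).form (projZero 𝒢 x) (projZero 𝒢 y) +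
        (cartanInner hσ).form (x - projZero 𝒢 x) (y - projZero 𝒢 y) := rfl

theorem lineInner_of_mem_nil (hrev : IsGradeReversing 𝒢 σ) (hZ : IsCharacteristicElement 𝒢 Z)
    (x : lineExtension (𝒢 := 𝒢) hH) {u : lineExtension (𝒢 := 𝒢) hH} (hu : (u : g) ∈ nil 𝒢) :
    (lineInner hσ hH c hc).form x u = (cartanInner hσ).form (x : g) u := by
  have h0 : projZero 𝒢 (x : g) ∈ 𝒢 0 := (DirectSum.decompose 𝒢 (x : g) 0).2
  rw [lineInner_apply, projZero_of_mem_nil hu, map_zero, mul_zero, zero_add, sub_zero, map_sub,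
    LinearMap.sub_apply, cartanInner_grade_zero_nil hσ hrev hZ h0 hu, sub_zero]

theorem lineInner_lineElement_of_mem_nil (hrev : IsGradeReversing 𝒢 σ)
    (hZ : IsCharacteristicElement 𝒢 Z) {u : lineExtension (𝒢 := 𝒢) hH} (hu : (u : g) ∈ nil 𝒢) :
    (lineInner hσ hH c hc).form (lineElement hH) u = 0 := by
  rw [lineInner_of_mem_nil hH hσ hc hrev hZ _ hu]
  exact cartanInner_grade_zero_nil hσ hrev hZ hH hu

theorem lineInner_lineElement :
    (lineInner hσ hH c hc).form (lineElement (𝒢 := 𝒢) hH) (lineElement hH) =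
      c * (cartanInner hσ).form H H := by
  have h : projZero 𝒢 (lineElement (𝒢 := 𝒢) hH : g) = H := projZero_of_mem hH
  have h' : (lineElement (𝒢 := 𝒢) hH : g) = H := rfl
  rw [lineInner_apply, h, h', sub_self, map_zero, add_zero]

theorem lineInner_lie_lineElement (hrev : IsGradeReversing 𝒢 σ)
    (hZ : IsCharacteristicElement 𝒢 Z) (hHp : H ∈ pSpace σ) (x y : lineExtension (𝒢 := 𝒢) hH) :
    (lineInner hσ hH c hc).form ⁅lineElement hH, x⁆ y =
      (lineInner hσ hH c hc).form x ⁅lineElement hH, y⁆ := by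
  have hx := lie_mem_nil_of_mem_lineExtension hH (lineElement hH) x
  have hy := lie_mem_nil_of_mem_lineExtension hH (lineElement hH) y
  rw [(lineInner hσ hH c hc).symm, lineInner_of_mem_nil hH hσ hc hrev hZ _ hx,
    lineInner_of_mem_nil hH hσ hc hrev hZ _ hy, (cartanInner hσ).symm]
  exact form_lie_of_mem_pSpace hσ hHp _ _

variable [Module.Finite ℝ g]

/-- In Koszul's formula one term vanishes because `H ⊥ [𝔰,𝔰]`, and the other two cancel because
`ad_H` is symmetric. -/
theorem leviCivita_lineElement (hrev : IsGradeReversing 𝒢 σ)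
    (hZ : IsCharacteristicElement 𝒢 Z) (hHp : H ∈ pSpace σ) (x : lineExtension (𝒢 := 𝒢) hH) :
    leviCivita (lineInner hσ hH c hc) (lineElement hH) x = 0 := by
  refine (lineInner hσ hH c hc).ext_form fun w => ?_
  have h0 := lineInner_lineElement_of_mem_nil hH hσ hc hrev hZ
    (lie_mem_nil_of_mem_lineExtension hH x w)
  rw [(lineInner hσ hH c hc).symm] at h0
  rw [form_leviCivita, h0, ← lie_skew w, map_neg, LinearMap.neg_apply,
    lineInner_lie_lineElement hH hσ hc hrev hZ hHp, (lineInner hσ hH c hc).symm x]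
  simp

theorem covDeriv_lineElement (hrev : IsGradeReversing 𝒢 σ)
    (hZ : IsCharacteristicElement 𝒢 Z) (hHp : H ∈ pSpace σ) :
    covDeriv (lineInner hσ hH c hc) (lineElement hH) =
      -LieAlgebra.ad ℝ (lineExtension (𝒢 := 𝒢) hH) (lineElement hH) := by
  ext x : 1
  rw [covDeriv_eq, LinearMap.sub_apply, leviCivita_lineElement hH hσ hc hrev hZ hHp, zero_sub,
    LinearMap.neg_apply]

/-- Because `∇_H = 0`, every `D_y` kills `H` and depends only on the `𝔫`-component of its argument.
-/
theorem covDeriv_nilProj (hrev : IsGradeReversing 𝒢 σ)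
    (hZ : IsCharacteristicElement 𝒢 Z) (hHp : H ∈ pSpace σ) (y x : lineExtension (𝒢 := 𝒢) hH) :
    covDeriv (lineInner hσ hH c hc) y (nilProj (nil_le_lineExtension hH) (x : g)) =
      covDeriv (lineInner hσ hH c hc) y x := by
  obtain ⟨t, u, hu, rfl⟩ := exists_eq_smul_lineElement_add hH x
  have h : nilProj (nil_le_lineExtension hH) (t • H + (u : g)) = u := by
    refine Subtype.ext ?_
    rw [coe_nilProj, map_add, map_smul, projPos_of_mem_zero hH, projPos_of_mem hu]
    simp
  have h' : ((t • lineElement hH + u : lineExtension (𝒢 := 𝒢) hH) : g) = t • H + u := rfl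
  rw [h', h, map_add, map_smul, covDeriv_apply _ (lineElement hH),
    leviCivita_lineElement hH hσ hc hrev hZ hHp]
  simp

/-- Both sides vanish on `𝔫`, so the coefficient is found by evaluating at `H`. It is the number `a`
that enters the Ricci form. -/
theorem trace_ad_lineExtension (hrev : IsGradeReversing 𝒢 σ) (hZ : IsCharacteristicElement 𝒢 Z)
    (hH0 : H ≠ 0) (x : lineExtension (𝒢 := 𝒢) hH) :
    LinearMap.trace ℝ _ (LieAlgebra.ad ℝ (lineExtension (𝒢 := 𝒢) hH) x) =
      traceNil 𝒢 H / (c * (cartanInner hσ).form H H) *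
        (lineInner hσ hH c hc).form (lineElement hH) x := by
  have hne := ((cartanInner hσ).pos H hH0).ne'
  obtain ⟨t, u, hu, rfl⟩ := exists_eq_smul_lineElement_add hH x
  rw [trace_ad_eq_traceNil (nil_le_lineExtension hH) (lie_mem_nil_of_mem_lineExtension hH),
    map_add, lineInner_lineElement_of_mem_nil hH hσ hc hrev hZ hu, map_smul,
    lineInner_lineElement hH hσ hc]
  change traceNil 𝒢 (t • H + (u : g)) = _
  rw [map_add, map_smul, traceNil_of_mem_nil hσ hrev hZ hu, smul_eq_mul, smul_eq_mul, add_zero,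
    add_zero, mul_left_comm, div_mul_cancel₀ _ (mul_ne_zero hc.ne' hne)]

theorem ricciForm_lineExtension (hrev : IsGradeReversing 𝒢 σ)
    (hZ : IsCharacteristicElement 𝒢 Z) (hHp : H ∈ pSpace σ) (hH0 : H ≠ 0)
    (y w : lineExtension (𝒢 := 𝒢) hH) :
    ricciForm (lineInner hσ hH c hc) y w =
      -(traceNil 𝒢 H / (c * (cartanInner hσ).form H H) *
        (lineInner hσ hH c hc).form ⁅lineElement hH, y⁆ w) -
      LinearMap.trace ℝ _
        (covDeriv (lineInner hσ hH c hc) y * covDeriv (lineInner hσ hH c hc) w) := by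
  have h : (lineInner hσ hH c hc).form (lineElement hH) (leviCivita (lineInner hσ hH c hc) y w) =
      (lineInner hσ hH c hc).form ⁅lineElement hH, y⁆ w := by
    have h0 := lineInner_lineElement_of_mem_nil hH hσ hc hrev hZ
      (lie_mem_nil_of_mem_lineExtension hH y w)
    rw [(lineInner hσ hH c hc).symm] at h0
    rw [(lineInner hσ hH c hc).symm, form_leviCivita, h0, ← lie_skew w, map_neg,
      LinearMap.neg_apply, lineInner_lie_lineElement hH hσ hc hrev hZ hHp w,
      (lineInner hσ hH c hc).symm w]
    ring
  rw [ricciForm_eq, trace_ad_lineExtension hH hσ hc hrev hZ hH0, h]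

theorem ricciForm_lineElement (hrev : IsGradeReversing 𝒢 σ)
    (hZ : IsCharacteristicElement 𝒢 Z) (hHp : H ∈ pSpace σ) (hH0 : H ≠ 0) :
    ricciForm (lineInner hσ hH c hc) (lineElement (𝒢 := 𝒢) hH) (lineElement hH) =
      -LinearMap.trace ℝ g (LieAlgebra.ad ℝ g H * LieAlgebra.ad ℝ g H * projPos 𝒢) := by
  rw [ricciForm_lineExtension hH hσ hc hrev hZ hHp hH0, lie_self, map_zero, LinearMap.zero_apply,
    mul_zero, neg_zero, zero_sub, covDeriv_lineElement hH hσ hc hrev hZ hHp, neg_mul_neg,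
    trace_eq_of_forall_mem_nil (nil_le_lineExtension hH)
      (fun x => lie_mem_nil_of_mem_lineExtension hH _ _)]
  rfl

/-- Only the `𝔫`-component of `D_y` is compared with `nilDeriv`. The `H`-component of its values is
dropped, which is harmless because the next `D` kills it. -/
theorem projPos_covDeriv_nilProj (hrev : IsGradeReversing 𝒢 σ) (hZ : IsCharacteristicElement 𝒢 Z)
    {y : lineExtension (𝒢 := 𝒢) hH} (hy : (y : g) ∈ nil 𝒢) :
    projPos 𝒢 * ((lineExtension (𝒢 := 𝒢) hH).toSubmodule.subtype ∘ₗ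
      covDeriv (lineInner hσ hH c hc) y ∘ₗ nilProj (nil_le_lineExtension hH)) =
      -(1 / 2 : ℝ) • nilDeriv 𝒢 σ y := by
  ext V
  refine (cartanInner hσ).ext_form fun W => ?_
  have hV := projPos_mem (𝒢 := 𝒢) V
  have hW := projPos_mem (𝒢 := 𝒢) W
  rw [LinearMap.smul_apply, nilDeriv_apply_eq, map_smul, LinearMap.smul_apply, Module.End.mul_apply,
    isAdjointPair_proj hσ hrev hZ, isAdjointPair_proj hσ hrev hZ,
    form_nilDeriv hσ hrev hZ _ hV hW]
  set q := nilProj (nil_le_lineExtension (𝒢 := 𝒢) hH) with hq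
  have h2 := lineInner_of_mem_nil hH hσ hc hrev hZ
    (covDeriv (lineInner hσ hH c hc) y (q V)) (u := q W) hW
  refine h2.symm.trans ?_
  have hl := lie_mem_nil_of_mem_lineExtension (𝒢 := 𝒢) hH
  rw [covDeriv_apply, form_leviCivita, lineInner_of_mem_nil hH hσ hc hrev hZ _ (u := q W) hW,
    lineInner_of_mem_nil hH hσ hc hrev hZ _ (u := q V) hV,
    lineInner_of_mem_nil hH hσ hc hrev hZ _ hy, ← lie_skew (q V), ← lie_skew (q W) (q V)]
  change 1 / 2 * ((cartanInner hσ).form (-⁅(y : g), projPos 𝒢 V⁆) (projPos 𝒢 W) -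
    (cartanInner hσ).form ⁅(y : g), projPos 𝒢 W⁆ (projPos 𝒢 V) +
    (cartanInner hσ).form (-⁅projPos 𝒢 V, projPos 𝒢 W⁆) (y : g)) = _
  rw [map_neg, map_neg, LinearMap.neg_apply, LinearMap.neg_apply, smul_eq_mul]
  ring

/-- The Ricci curvature of `ℝH + 𝔫` on `𝔫`. -/
theorem ricciForm_of_mem_nil (hrev : IsGradeReversing 𝒢 σ)
    (hZ : IsCharacteristicElement 𝒢 Z) (hHp : H ∈ pSpace σ) (hH0 : H ≠ 0)
    {y w : lineExtension (𝒢 := 𝒢) hH} (hy : (y : g) ∈ nil 𝒢) (hw : (w : g) ∈ nil 𝒢) :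
    ricciForm (lineInner hσ hH c hc) y w =
      -(traceNil 𝒢 H / (c * (cartanInner hσ).form H H) * (cartanInner hσ).form ⁅H, (y : g)⁆ w) +
      1 / 2 * (cartanInner hσ).form ⁅nilVector 𝒢 hσ, (y : g)⁆ w -
      1 / 4 * (cartanInner hσ).form (y : g) w := by
  have htr : LinearMap.trace ℝ _
      (covDeriv (lineInner hσ hH c hc) y * covDeriv (lineInner hσ hH c hc) w) =
      1 / 4 * LinearMap.trace ℝ g (nilDeriv 𝒢 σ y * nilDeriv 𝒢 σ w) := by
    set ι := (lineExtension (𝒢 := 𝒢) hH).toSubmodule.subtype with hι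
    set q := nilProj (nil_le_lineExtension (𝒢 := 𝒢) hH) with hq
    set My := covDeriv (lineInner hσ hH c hc) y with hMy
    set Mw := covDeriv (lineInner hσ hH c hc) w with hMw
    -- Inserting the projection before each factor costs nothing, since both kill `H`; the product
    -- then passes through `𝔤`, where its trace is computed.
    have e1 : My * Mw = (My ∘ₗ q ∘ₗ ι ∘ₗ Mw ∘ₗ q) ∘ₗ ι := by
      ext x : 1
      have h1 := covDeriv_nilProj hH hσ hc hrev hZ hHp w x
      have h2 := covDeriv_nilProj hH hσ hc hrev hZ hHp y (Mw x)
      change My (Mw x) = My (q (Mw (q (x : g)) : g))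
      rw [h1, h2]
    have e2 : (ι ∘ₗ My ∘ₗ q) * (projPos 𝒢 * (ι ∘ₗ Mw ∘ₗ q) * projPos 𝒢) =
        ι ∘ₗ (My ∘ₗ q ∘ₗ ι ∘ₗ Mw ∘ₗ q) := by
      ext V
      change (My (q (projPos 𝒢 (Mw (q (projPos 𝒢 V)) : g))) : g) = (My (q (Mw (q V) : g)) : g)
      rw [hq, nilProj_projPos, nilProj_projPos]
    rw [e1, LinearMap.trace_comp_comm', ← e2, ← mul_assoc, LinearMap.trace_mul_comm, ← mul_assoc,
      projPos_covDeriv_nilProj hH hσ hc hrev hZ hy, projPos_covDeriv_nilProj hH hσ hc hrev hZ hw,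
      smul_mul_smul_comm, map_smul, smul_eq_mul]
    norm_num
  rw [ricciForm_lineExtension hH hσ hc hrev hZ hHp hH0, htr,
    trace_nilDeriv_mul_nilDeriv hσ hrev hZ hy hw, lineInner_of_mem_nil hH hσ hc hrev hZ _ hw]
  change -(_ * (cartanInner hσ).form ⁅H, (y : g)⁆ w) - _ = _
  ring

end line

end GradedLie

/-! ### Effectiveness and the consequences of the Einstein equation -/

namespace GradedLie

variable {g : Type*} [LieRing g] [LieAlgebra ℝ g]
variable {𝒢 : ℤ → Submodule ℝ g} [GradedLieAlgebra 𝒢] {σ : g ≃ₗ⁅ℝ⁆ g} {Z : g}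

/-- In an effective gradation, an element of `𝔭 ∩ 𝔤_0` that centralizes `𝔫` vanishes. -/
theorem eq_zero_of_lie_nil_eq_zero (heff : ∀ I : LieIdeal ℝ g, I.toSubmodule ≤ 𝒢 0 → I = ⊥)
    (hσ : IsCartanInvolution σ) (hrev : IsGradeReversing 𝒢 σ) {T : g} (hT0 : T ∈ 𝒢 0)
    (hTp : T ∈ pSpace σ) (hT : ∀ X ∈ nil 𝒢, ⁅T, X⁆ = 0) : T = 0 := by
  -- The centralizer of `𝔫 + σ𝔫` in `𝔤_0`. Brackets with nonzero degrees vanish on it and the Jacobi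
  -- identity handles degree zero, so it is an ideal inside `𝔤_0`. It contains `T` because `σ T =
  -- -T`.
  let I : LieIdeal ℝ g :=
    { carrier := {X | X ∈ 𝒢 0 ∧ ∀ U ∈ nil 𝒢, ⁅X, U⁆ = 0 ∧ ⁅X, σ U⁆ = 0}
      add_mem' := fun {X Y} hX hY => ⟨add_mem hX.1 hY.1, fun U hU => by
        rw [add_lie, add_lie, (hX.2 U hU).1, (hX.2 U hU).2, (hY.2 U hU).1, (hY.2 U hU).2]
        simp⟩
      zero_mem' := ⟨zero_mem _, fun U _ => by simp⟩
      smul_mem' := fun t X hX => ⟨Submodule.smul_mem _ _ hX.1, fun U hU => by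
        rw [smul_lie, smul_lie, (hX.2 U hU).1, (hX.2 U hU).2]
        simp⟩
      lie_mem := fun {Y X} hX => by
        obtain ⟨hX0, hX⟩ := hX
        have key : ∀ k, ∀ Y ∈ 𝒢 k, ⁅Y, X⁆ ∈ 𝒢 0 ∧ ∀ U ∈ nil 𝒢, ⁅⁅Y, X⁆, U⁆ = 0 ∧
            ⁅⁅Y, X⁆, σ U⁆ = 0 := by
          intro k Y hY
          rcases lt_trichotomy k 0 with hk | hk | hk
          · have h := (hX (σ Y) (mem_nil_of_mem (by lia) (map_mem_grade hrev hY))).2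
            rw [hσ.invol, ← lie_skew, neg_eq_zero] at h
            rw [h]
            exact ⟨zero_mem _, fun U _ => by simp⟩
          · subst hk
            refine ⟨by simpa using SetLike.GradedBracket.bracket_mem (ℒ := 𝒢) hY hX0,
              fun U hU => ?_⟩
            have h1 := hX _ (lie_grade_zero_mem_nil 𝒢 hY hU)
            have h2 := hX _ (lie_grade_zero_mem_nil 𝒢
              (by simpa using map_mem_grade hrev hY : σ Y ∈ 𝒢 0) hU)
            rw [LieEquiv.map_lie σ (σ Y), hσ.invol] at h2
            rw [lie_lie, lie_lie, (hX U hU).1, (hX U hU).2, h1.1, h2.2]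
            simp
          · have h := (hX Y (mem_nil_of_mem hk hY)).1
            rw [← lie_skew, neg_eq_zero] at h
            rw [h]
            exact ⟨zero_mem _, fun U _ => by simp⟩
        change ⁅Y, X⁆ ∈ 𝒢 0 ∧ ∀ U ∈ nil 𝒢, ⁅⁅Y, X⁆, U⁆ = 0 ∧ ⁅⁅Y, X⁆, σ U⁆ = 0
        induction Y using DirectSum.Decomposition.inductionOn 𝒢 with
        | zero => simp
        | @homogeneous i y => exact key i y y.2
        | add y y' h h' =>
          refine ⟨by rw [add_lie]; exact add_mem h.1 h'.1, fun U hU => ?_⟩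
          rw [add_lie, add_lie, add_lie, (h.2 U hU).1, (h.2 U hU).2, (h'.2 U hU).1,
            (h'.2 U hU).2]
          simp }
  have hI : I = ⊥ := heff I fun X hX => hX.1
  have hTI : T ∈ I := by
    refine ⟨hT0, fun U hU => ⟨hT U hU, ?_⟩⟩
    have h : ⁅T, σ U⁆ = σ ⁅σ T, U⁆ := by rw [LieEquiv.map_lie, hσ.invol]
    have hTp' : σ T = -T := hTp
    rw [h, hTp', neg_lie, hT U hU]
    simp
  rw [hI] at hTI
  exact (LieSubmodule.mem_bot T).1 hTI

/-- If `𝔫 = 0`, then also `σ𝔫 = 0`, so `𝔤 = 𝔤_0` is itself an ideal excluded by effectiveness. -/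
theorem subsingleton_of_nil_eq_zero (heff : ∀ I : LieIdeal ℝ g, I.toSubmodule ≤ 𝒢 0 → I = ⊥)
    (hσ : IsCartanInvolution σ) (hrev : IsGradeReversing 𝒢 σ)
    (h : ∀ X ∈ nil 𝒢, X = 0) : Subsingleton g := by
  have h0 : (⊤ : LieIdeal ℝ g) = ⊥ := heff ⊤ fun Y _ => by
    induction Y using DirectSum.Decomposition.inductionOn 𝒢 with
    | zero => exact zero_mem _
    | @homogeneous i y =>
      rcases lt_trichotomy i 0 with hk | hk | hk
      · have h1 := h _ (mem_nil_of_mem (by lia) (map_mem_grade hrev y.2))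
        have h2 := hσ.invol y
        rw [h1, map_zero] at h2
        rw [← h2]
        exact zero_mem _
      · subst hk
        exact y.2
      · rw [h _ (mem_nil_of_mem hk y.2)]
        exact zero_mem _
    | add y y' h h' => exact add_mem (h trivial) (h' trivial)
  refine ⟨fun x y => ?_⟩
  have hx : x ∈ (⊤ : LieIdeal ℝ g) := trivial
  have hy : y ∈ (⊤ : LieIdeal ℝ g) := trivial
  rw [h0, LieSubmodule.mem_bot] at hx hy
  rw [hx, hy]

variable [Module.Finite ℝ g]

theorem traceNil_pos (hσ : IsCartanInvolution σ) {H : g} (hH : H ∈ 𝒢 0) (hHp : H ∈ pSpace σ)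
    (hpos : ∀ (μ : ℝ) (X : g), X ∈ nil 𝒢 → X ≠ 0 → ⁅H, X⁆ = μ • X → 0 < μ)
    (hn : ∃ X ∈ nil 𝒢, X ≠ 0) : 0 < traceNil 𝒢 H := by
  obtain ⟨X, hX, hX0⟩ := hn
  have : Nontrivial (nil 𝒢) := ⟨⟨⟨X, hX⟩, 0, fun h => hX0 (congrArg Subtype.val h)⟩⟩
  let f : Module.End ℝ (nil 𝒢) :=
    (LieAlgebra.ad ℝ g H).restrict (p := (nil 𝒢).toSubmodule) (q := (nil 𝒢).toSubmodule)
      fun _ hX => lie_grade_zero_mem_nil 𝒢 hH hX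
  have hf : 0 < LinearMap.trace ℝ _ f :=
    ((cartanInner hσ).restrict (nil 𝒢).toSubmodule).trace_pos_of_eigenvalues_pos (f := f)
      (fun x y => form_lie_of_mem_pSpace hσ hHp (x : g) y)
      fun μ x hx hμ => hpos μ x x.2 (fun h => hx (Subtype.ext h)) (congrArg Subtype.val hμ)
  rw [trace_eq_of_forall_mem_nil le_rfl (fun x => (f x).2)] at hf
  exact hf

omit [Module.Finite ℝ g] in
/-- If `H ∈ 𝔭 ∩ 𝔤_0` is central in `𝔤_0`, then `|H|² = 2 tr(ad_H²|𝔫)`. -/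
theorem cartanInner_self_eq (hσ : IsCartanInvolution σ) (hrev : IsGradeReversing 𝒢 σ) {H : g}
    (hHp : H ∈ pSpace σ) (hcent : ∀ U ∈ 𝒢 0, ⁅H, U⁆ = 0) :
    (cartanInner hσ).form H H =
      2 * LinearMap.trace ℝ g (LieAlgebra.ad ℝ g H * LieAlgebra.ad ℝ g H * projPos 𝒢) := by
  have hHp' : σ H = -H := hHp
  have h0 : LieAlgebra.ad ℝ g H * LieAlgebra.ad ℝ g H * projZero 𝒢 = 0 := by
    ext X
    have : projZero 𝒢 X ∈ 𝒢 0 := (DirectSum.decompose 𝒢 X 0).2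
    simp [hcent _ this]
  -- Conjugation by `σ` exchanges the two halves of the gradation and fixes `ad_H²`, as `σ H = -H`.
  have hneg : LinearMap.trace ℝ g (LieAlgebra.ad ℝ g H * LieAlgebra.ad ℝ g H * projNeg 𝒢) =
      LinearMap.trace ℝ g (LieAlgebra.ad ℝ g H * LieAlgebra.ad ℝ g H * projPos 𝒢) := by
    have hc : LieAlgebra.ad ℝ g H * LieAlgebra.ad ℝ g H * projNeg 𝒢 =
        (σ : g ≃ₗ[ℝ] g).conj (LieAlgebra.ad ℝ g H * LieAlgebra.ad ℝ g H * projPos 𝒢) := by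
      ext X
      have hs : (σ : g ≃ₗ[ℝ] g).symm X = σ X := by
        rw [LinearEquiv.symm_apply_eq]
        exact (hσ.invol X).symm
      rw [LinearEquiv.conj_apply_apply, hs]
      change ⁅H, ⁅H, projNeg 𝒢 X⁆⁆ = σ ⁅H, ⁅H, projPos 𝒢 (σ X)⁆⁆
      rw [LieEquiv.map_lie, LieEquiv.map_lie, map_projPos hrev, hσ.invol, hHp']
      rw [neg_lie, neg_lie, lie_neg, neg_neg]
    rw [hc, LinearMap.trace_conj']
  have htr : (cartanInner hσ).form H H =
      LinearMap.trace ℝ g (LieAlgebra.ad ℝ g H * LieAlgebra.ad ℝ g H *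
        (projPos 𝒢 + projZero 𝒢 + projNeg 𝒢)) := by
    rw [projPos_add_projZero_add_projNeg, mul_one, cartanInner_form, hHp', map_neg, neg_neg,
      killingForm_apply_apply]
    rfl
  rw [htr, mul_add, mul_add, map_add, map_add, h0, hneg, map_zero]
  ring

/-- If `𝔫` is abelian, then `ad_{H₀}` is `1/2` on `𝔫`. -/
theorem nilVector_lie_of_abelian (hσ : IsCartanInvolution σ) (hrev : IsGradeReversing 𝒢 σ)
    (hZ : IsCharacteristicElement 𝒢 Z) (hab : ∀ X ∈ nil 𝒢, ∀ Y ∈ nil 𝒢, ⁅X, Y⁆ = 0)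
    {Y : g} (hY : Y ∈ nil 𝒢) : ⁅nilVector 𝒢 hσ, Y⁆ = (1 / 2 : ℝ) • Y := by
  -- Every term of `form_nilDeriv` contains a bracket in `𝔫`, so the trace identity reduces to `0 =
  -- ⟨Y,W⟩ - 2⟨[H₀,Y],W⟩`.
  have hN : nilDeriv 𝒢 σ Y = 0 := by
    ext V
    refine (cartanInner hσ).ext_form fun W => ?_
    have hV := projPos_mem (𝒢 := 𝒢) V
    have hW := projPos_mem (𝒢 := 𝒢) W
    rw [nilDeriv_apply_eq, isAdjointPair_proj hσ hrev hZ, form_nilDeriv hσ hrev hZ _ hV hW,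
      hab _ hY _ hV, hab _ hY _ hW, hab _ hV _ hW]
    simp
  have hD := lie_grade_zero_mem_nil 𝒢 (nilVector_mem_grade_zero hσ hrev hZ) hY
  have key (W : g) (hW : W ∈ nil 𝒢) :
      (cartanInner hσ).form (⁅nilVector 𝒢 hσ, Y⁆ - (1 / 2 : ℝ) • Y) W = 0 := by
    have h := trace_nilDeriv_mul_nilDeriv hσ hrev hZ hY hW
    rw [hN, zero_mul, map_zero] at h
    rw [map_sub, LinearMap.sub_apply, map_smul, LinearMap.smul_apply, smul_eq_mul]
    linarith
  rw [← sub_eq_zero]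
  by_contra hne
  exact ((cartanInner hσ).pos _ hne).ne'
    (key _ (sub_mem hD ((nil 𝒢).toSubmodule.smul_mem _ hY)))

section line

variable {H : g} {hH : H ∈ 𝒢 0} {hσ : IsCartanInvolution σ} {c : ℝ} {hc : 0 < c} {s : ℝ}

/-- The Einstein equation restricted to `𝔫`. The difference of the two sides lies in `𝔫` and is
orthogonal to `𝔫`. Collecting the operators into one `ad` keeps it visibly a derivation and prepares
for effectiveness. -/
theorem lie_eq_of_ricciForm_eq (hrev : IsGradeReversing 𝒢 σ)
    (hZ : IsCharacteristicElement 𝒢 Z) (hHp : H ∈ pSpace σ) (hH0 : H ≠ 0)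
    (hs : ∀ x y, ricciForm (lineInner hσ hH c hc) x y = s * (lineInner hσ hH c hc).form x y)
    {Y : g} (hY : Y ∈ nil 𝒢) :
    ⁅(1 / 2 : ℝ) • nilVector 𝒢 hσ - (traceNil 𝒢 H / (c * (cartanInner hσ).form H H)) • H, Y⁆ =
      (s + 1 / 4) • Y := by
  have key (W : g) (hW : W ∈ nil 𝒢) : (cartanInner hσ).form
      (⁅(1 / 2 : ℝ) • nilVector 𝒢 hσ - (traceNil 𝒢 H / (c * (cartanInner hσ).form H H)) • H, Y⁆ -
        (s + 1 / 4) • Y) W = 0 := by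
    have h := hs ⟨Y, nil_le_lineExtension hH hY⟩ ⟨W, nil_le_lineExtension hH hW⟩
    rw [ricciForm_of_mem_nil hH hσ hc hrev hZ hHp hH0 hY hW,
      lineInner_of_mem_nil hH hσ hc hrev hZ _ hW] at h
    simp only [sub_lie, smul_lie, map_sub, map_smul, LinearMap.sub_apply, LinearMap.smul_apply,
      smul_eq_mul]
    linarith
  rw [← sub_eq_zero]
  by_contra hne
  have hD := lie_grade_zero_mem_nil 𝒢 (nilVector_mem_grade_zero hσ hrev hZ) hY
  have hD' := lie_grade_zero_mem_nil 𝒢 hH hY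
  have hmem : ⁅(1 / 2 : ℝ) • nilVector 𝒢 hσ -
      (traceNil 𝒢 H / (c * (cartanInner hσ).form H H)) • H, Y⁆ - (s + 1 / 4) • Y ∈ nil 𝒢 := by
    rw [sub_lie, smul_lie, smul_lie]
    exact sub_mem (sub_mem ((nil 𝒢).toSubmodule.smul_mem _ hD)
      ((nil 𝒢).toSubmodule.smul_mem _ hD')) ((nil 𝒢).toSubmodule.smul_mem _ hY)
  exact ((cartanInner hσ).pos _ hne).ne' (key _ hmem)

/-- Parallelism makes `H` central in `𝔤_0`, so `ric(H,H) = -tr(ad_H²|𝔫) = -|H|²/2`, to be compared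
with `s c |H|²`. -/
theorem einsteinConstant_eq (hrev : IsGradeReversing 𝒢 σ)
    (hZ : IsCharacteristicElement 𝒢 Z) (hHp : H ∈ pSpace σ) (hH0 : H ≠ 0)
    (hs : ∀ x y, ricciForm (lineInner hσ hH c hc) x y = s * (lineInner hσ hH c hc).form x y)
    (hpar : Parallel H (nilVector 𝒢 hσ)) : s = -(1 / (2 * c)) := by
  have hcent : ∀ U ∈ 𝒢 0, ⁅H, U⁆ = 0 := by
    obtain ⟨t, -, rfl⟩ := hpar
    intro U hU
    rw [smul_lie, ← lie_skew, lie_nilVector hσ hrev hU]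
    simp
  have h := hs (lineElement hH) (lineElement hH)
  rw [ricciForm_lineElement hH hσ hc hrev hZ hHp hH0, lineInner_lineElement] at h
  have h1 := cartanInner_self_eq hσ hrev hHp hcent
  have h2 : (cartanInner hσ).form H H * (s * (2 * c) + 1) = 0 := by linarith
  have h3 := (mul_eq_zero.1 h2).resolve_left ((cartanInner hσ).pos H hH0).ne'
  rw [← neg_div, eq_div_iff (by positivity)]
  linarith

theorem parallel_of_abelian (heff : ∀ I : LieIdeal ℝ g, I.toSubmodule ≤ 𝒢 0 → I = ⊥)
    (hrev : IsGradeReversing 𝒢 σ)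
    (hZ : IsCharacteristicElement 𝒢 Z) (hHp : H ∈ pSpace σ) (hH0 : H ≠ 0)
    (htr : 0 < traceNil 𝒢 H)
    (hs : ∀ x y, ricciForm (lineInner hσ hH c hc) x y = s * (lineInner hσ hH c hc).form x y)
    (hab : ∀ X ∈ nil 𝒢, ∀ Y ∈ nil 𝒢, ⁅X, Y⁆ = 0) : Parallel H (nilVector 𝒢 hσ) := by
  have ha := div_pos htr (mul_pos hc ((cartanInner hσ).pos H hH0))
  have hl := fun X hX => lie_eq_of_ricciForm_eq hrev hZ hHp hH0 hs (Y := X) hX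
  generalize traceNil 𝒢 H / (c * (cartanInner hσ).form H H) = a at ha hl
  have hv0 := nilVector_mem_grade_zero hσ hrev hZ
  have hvp : nilVector 𝒢 hσ ∈ pSpace σ := map_nilVector hσ hrev hZ
  -- On `𝔫` one has `ad_{H₀} = 1/2`, so the Einstein equation reads `a ad_H = -s`; the coefficient
  -- `2s` cancels this.
  have hT : a • H + (2 * s) • nilVector 𝒢 hσ = 0 := by
    refine eq_zero_of_lie_nil_eq_zero heff hσ hrev
      (add_mem (Submodule.smul_mem _ _ hH) (Submodule.smul_mem _ _ hv0))
      (add_mem (Submodule.smul_mem _ _ hHp) (Submodule.smul_mem _ _ hvp)) fun X hX => ?_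
    have h1 := hl X hX
    have h2 := nilVector_lie_of_abelian hσ hrev hZ hab hX
    rw [sub_lie, smul_lie, smul_lie, h2] at h1
    have h3 : a • ⁅H, X⁆ = (1 / 2 : ℝ) • (1 / 2 : ℝ) • X - (s + 1 / 4) • X := by
      rw [← h1]
      abel
    rw [add_lie, smul_lie, smul_lie, h2, h3]
    module
  have hH' : H = (-(2 * s) / a) • nilVector 𝒢 hσ := by
    rw [div_eq_inv_mul, mul_smul, neg_smul, ← eq_neg_of_add_eq_zero_left hT, inv_smul_smul₀ ha.ne']
  refine ⟨_, fun h => hH0 ?_, hH'⟩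
  rw [hH', h, zero_smul]

theorem eq_and_parallel_of_not_abelian (heff : ∀ I : LieIdeal ℝ g, I.toSubmodule ≤ 𝒢 0 → I = ⊥)
    (hrev : IsGradeReversing 𝒢 σ)
    (hZ : IsCharacteristicElement 𝒢 Z) (hHp : H ∈ pSpace σ) (hH0 : H ≠ 0)
    (htr : 0 < traceNil 𝒢 H)
    (hs : ∀ x y, ricciForm (lineInner hσ hH c hc) x y = s * (lineInner hσ hH c hc).form x y)
    (hab : ¬ ∀ X ∈ nil 𝒢, ∀ Y ∈ nil 𝒢, ⁅X, Y⁆ = 0) :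
    s = -(1 / 4) ∧ Parallel H (nilVector 𝒢 hσ) := by
  have ha := div_pos htr (mul_pos hc ((cartanInner hσ).pos H hH0))
  have hl := fun X hX => lie_eq_of_ricciForm_eq hrev hZ hHp hH0 hs (Y := X) hX
  generalize traceNil 𝒢 H / (c * (cartanInner hσ).form H H) = a at ha hl
  have hv0 := nilVector_mem_grade_zero hσ hrev hZ
  have hvp : nilVector 𝒢 hσ ∈ pSpace σ := map_nilVector hσ hrev hZ
  -- A derivation equal to the scalar `r` on `𝔫` acts on a nonzero bracket both by `r` and by `2r`,
  -- so `r = 0`.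
  have hr : s + 1 / 4 = 0 := by
    push Not at hab
    obtain ⟨X, hX, Y, hY, hXY⟩ := hab
    have h := hl _ ((nil 𝒢).lie_mem hX hY)
    rw [leibniz_lie, hl X hX, hl Y hY, smul_lie, lie_smul, ← add_smul, ← sub_eq_zero,
      ← sub_smul] at h
    have := (smul_eq_zero.1 h).resolve_right hXY
    linarith
  have hT : (1 / 2 : ℝ) • nilVector 𝒢 hσ - a • H = 0 := by
    refine eq_zero_of_lie_nil_eq_zero heff hσ hrev
      (sub_mem (Submodule.smul_mem _ _ hv0) (Submodule.smul_mem _ _ hH))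
      (sub_mem (Submodule.smul_mem _ _ hvp) (Submodule.smul_mem _ _ hHp)) fun X hX => ?_
    rw [hl X hX, hr, zero_smul]
  refine ⟨by linarith, a⁻¹ * (1 / 2), by positivity, ?_⟩
  rw [mul_smul, sub_eq_zero.1 hT, inv_smul_smul₀ ha.ne']

theorem isEinstein_of_parallel (hrev : IsGradeReversing 𝒢 σ)
    (hZ : IsCharacteristicElement 𝒢 Z) (hHp : H ∈ pSpace σ) (hH0 : H ≠ 0)
    (hab : ∀ X ∈ nil 𝒢, ∀ Y ∈ nil 𝒢, ⁅X, Y⁆ = 0) (hpar : Parallel H (nilVector 𝒢 hσ)) :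
    IsEinstein (lineInner hσ hH c hc) := by
  obtain ⟨t, -, ht⟩ := hpar
  have hHl (Y : g) (hY : Y ∈ nil 𝒢) : ⁅H, Y⁆ = (t / 2) • Y := by
    rw [ht, smul_lie, nilVector_lie_of_abelian hσ hrev hZ hab hY, smul_smul]
    congr 1
    ring
  have hne := (mul_pos hc ((cartanInner hσ).pos H hH0)).ne'
  set m := lineInner hσ hH c hc with hm
  set h := lineElement (𝒢 := 𝒢) hH with hh
  have hsq : LieAlgebra.ad ℝ g H * LieAlgebra.ad ℝ g H * projPos 𝒢 =
      (t / 2) • (LieAlgebra.ad ℝ g H * projPos 𝒢) := by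
    ext V
    change ⁅H, ⁅H, projPos 𝒢 V⁆⁆ = (t / 2) • ⁅H, projPos 𝒢 V⁆
    conv_lhs => rw [hHl _ (projPos_mem V), lie_smul]
  have hhh : ricciForm m h h = -(t / 2) * traceNil 𝒢 H := by
    rw [ricciForm_lineElement hH hσ hc hrev hZ hHp hH0, hsq, map_smul, smul_eq_mul, neg_mul,
      traceNil_apply]
  -- Here `D_H = -ad_H` is `-t/2` times the projection onto `𝔫`. For `v ∈ 𝔫` this reduces `tr(D_v
  -- D_H)` to a multiple of `tr D_v = -tr ad_v = 0`, so the mixed Ricci terms vanish.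
  have hcov : covDeriv m h = -(t / 2) •
      (nilProj (nil_le_lineExtension hH) ∘ₗ (lineExtension (𝒢 := 𝒢) hH).toSubmodule.subtype) := by
    rw [hm, hh, covDeriv_lineElement hH hσ hc hrev hZ hHp, neg_smul, neg_inj]
    ext x
    obtain ⟨r, u, hu, rfl⟩ := exists_eq_smul_lineElement_add hH x
    change ⁅H, r • H + (u : g)⁆ = (t / 2) • projPos 𝒢 (r • H + (u : g))
    rw [lie_add, lie_smul, lie_self, hHl _ hu, map_add, map_smul, projPos_of_mem_zero hH,
      projPos_of_mem hu]
    simp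
  have htr (v : lineExtension (𝒢 := 𝒢) hH) (hv : (v : g) ∈ nil 𝒢) :
      LinearMap.trace ℝ _ (covDeriv m v * covDeriv m h) = 0 := by
    have h1 : covDeriv m v * covDeriv m h = -(t / 2) • covDeriv m v := by
      rw [hcov, mul_smul_comm]
      congr 1
      ext x : 1
      exact covDeriv_nilProj hH hσ hc hrev hZ hHp v x
    rw [h1, map_smul, trace_covDeriv, trace_ad_eq_traceNil (nil_le_lineExtension hH)
      (lie_mem_nil_of_mem_lineExtension hH), traceNil_of_mem_nil hσ hrev hZ hv]
    simp
  have hform (u : lineExtension (𝒢 := 𝒢) hH) (hu : (u : g) ∈ nil 𝒢) : m.form h u = 0 :=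
    lineInner_lineElement_of_mem_nil hH hσ hc hrev hZ hu
  have huh (u : lineExtension (𝒢 := 𝒢) hH) (hu : (u : g) ∈ nil 𝒢) : ricciForm m u h = 0 := by
    rw [ricciForm_lineExtension hH hσ hc hrev hZ hHp hH0, htr u hu, m.symm,
      hform _ (lie_mem_nil_of_mem_lineExtension hH _ _)]
    simp
  have hhu (u : lineExtension (𝒢 := 𝒢) hH) (hu : (u : g) ∈ nil 𝒢) : ricciForm m h u = 0 := by
    rw [ricciForm_lineExtension hH hσ hc hrev hZ hHp hH0, LinearMap.trace_mul_comm, htr u hu,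
      lie_self]
    simp
  have huv (u v : lineExtension (𝒢 := 𝒢) hH) (hu : (u : g) ∈ nil 𝒢) (hv : (v : g) ∈ nil 𝒢) :
      ricciForm m u v =
        -(t / 2) * (traceNil 𝒢 H / (c * (cartanInner hσ).form H H)) * m.form u v := by
    rw [ricciForm_of_mem_nil hH hσ hc hrev hZ hHp hH0 hu hv, hHl _ hu,
      nilVector_lie_of_abelian hσ hrev hZ hab hu, lineInner_of_mem_nil hH hσ hc hrev hZ _ hv]
    simp only [map_smul, LinearMap.smul_apply, smul_eq_mul]
    ring
  -- On `𝔫` the terms `1/2 ad_{H₀} = 1/4` and `-1/4` cancel, leaving `-a ad_H = -(t/2) a`; this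
  -- agrees with `ric(H,H) / (c|H|²)`.
  refine ⟨-(t / 2) * (traceNil 𝒢 H / (c * (cartanInner hσ).form H H)),
    (ricci_eq_smul_iff m).2 fun x y => ?_⟩
  obtain ⟨r, u, hu, rfl⟩ := exists_eq_smul_lineElement_add hH x
  obtain ⟨r', v, hv, rfl⟩ := exists_eq_smul_lineElement_add hH y
  have hb : m.form h h = c * (cartanInner hσ).form H H := lineInner_lineElement hH hσ hc
  simp only [map_add, map_smul, LinearMap.add_apply, LinearMap.smul_apply, smul_eq_mul]
  rw [← hh, hhh, hhu v hv, huh u hu, huv u v hu hv, hform v hv, m.symm u h, hform u hu, hb]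
  linear_combination r' * r * (t / 2) * div_mul_cancel₀ (traceNil 𝒢 H) hne

end line

end GradedLie

theorem mainTheorem2 {g : Type*} [LieRing g] [LieAlgebra ℝ g] [Module.Finite ℝ g]
    [LieAlgebra.IsSemisimple ℝ g]
    (𝒢 : ℤ → Submodule ℝ g) [GradedLieAlgebra 𝒢]
    (hα : IsTypeAlphaZero 𝒢)
    (heff : ∀ I : LieIdeal ℝ g, I.toSubmodule ≤ 𝒢 0 → I = ⊥)
    (σ : g ≃ₗ⁅ℝ⁆ g) (hσ : IsCartanInvolution σ) (hrev : IsGradeReversing 𝒢 σ)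
    (Z : g) (hZ : IsCharacteristicElement 𝒢 Z)
    (𝔞 : Submodule ℝ g) (h𝔞 : IsMaximalAbelian σ 𝔞) (hZ𝔞 : Z ∈ 𝔞)
    (H : g) (hH : H ∈ 𝔞)
    (hpos : ∀ (μ : ℝ) (X : g), X ∈ nil 𝒢 → X ≠ 0 → ⁅H, X⁆ = μ • X → 0 < μ)
    (c : ℝ) (hc : 0 < c) :
    (IsEinstein (lineInner hσ (h𝔞.mem_grade_zero hZ hZ𝔞 hH) c hc) →
      ricci (lineInner hσ (h𝔞.mem_grade_zero hZ hZ𝔞 hH) c hc)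
          (lineElement (h𝔞.mem_grade_zero hZ hZ𝔞 hH)) =
        (-(1 / (2 * c))) • lineElement (h𝔞.mem_grade_zero hZ hZ𝔞 hH)) ∧
    (IsLieAbelian (nil 𝒢) →
      (IsEinstein (lineInner hσ (h𝔞.mem_grade_zero hZ hZ𝔞 hH) c hc) ↔
        Parallel H (meanCurvature hσ h𝔞.prop.2 (le_grade_zero hZ h𝔞.prop.2 hZ𝔞)))) ∧
    (¬ IsLieAbelian (nil 𝒢) →
      IsEinstein (lineInner hσ (h𝔞.mem_grade_zero hZ hZ𝔞 hH) c hc) →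
        c = 2 ∧
          Parallel H (meanCurvature hσ h𝔞.prop.2 (le_grade_zero hZ h𝔞.prop.2 hZ𝔞))) := by
  have hH' := h𝔞.mem_grade_zero hZ hZ𝔞 hH
  have hHp : H ∈ pSpace σ := h𝔞.prop.1 hH
  rw [meanCurvature_eq_nilVector hσ hrev hZ h𝔞 hZ𝔞]
  have habel : IsLieAbelian (nil 𝒢) ↔ ∀ X ∈ nil 𝒢, ∀ Y ∈ nil 𝒢, ⁅X, Y⁆ = 0 :=
    ⟨fun h X hX Y hY => congrArg Subtype.val (h.trivial ⟨X, hX⟩ ⟨Y, hY⟩),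
      fun h => ⟨fun X Y => Subtype.ext (h X X.2 Y Y.2)⟩⟩
  rw [habel]
  -- Positivity of the eigenvalues forces `H ≠ 0` only when `𝔫 ≠ 0`; otherwise `𝔤 = 0` and all
  -- claims are trivial.
  by_cases hn : ∃ X ∈ nil 𝒢, X ≠ 0
  · have hH0 : H ≠ 0 := by
      rintro rfl
      obtain ⟨X, hX, hX0⟩ := hn
      exact lt_irrefl _ (hpos 0 X hX hX0 (by simp))
    have htr := traceNil_pos hσ hH' hHp hpos hn
    refine ⟨fun ⟨s, hs⟩ => ?_, fun hab => ⟨fun ⟨s, hs⟩ => ?_, fun hpar => ?_⟩,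
      fun hab ⟨s, hs⟩ => ?_⟩
    · have hs' := (ricci_eq_smul_iff _).1 hs
      have hpar : Parallel H (nilVector 𝒢 hσ) := by
        by_cases hab : ∀ X ∈ nil 𝒢, ∀ Y ∈ nil 𝒢, ⁅X, Y⁆ = 0
        · exact parallel_of_abelian heff hrev hZ hHp hH0 htr hs' hab
        · exact (eq_and_parallel_of_not_abelian heff hrev hZ hHp hH0 htr hs' hab).2
      rw [hs, einsteinConstant_eq hrev hZ hHp hH0 hs' hpar]
    · exact parallel_of_abelian heff hrev hZ hHp hH0 htr ((ricci_eq_smul_iff _).1 hs) hab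
    · exact isEinstein_of_parallel hrev hZ hHp hH0 hab hpar
    · have hs' := (ricci_eq_smul_iff _).1 hs
      obtain ⟨h1, hpar⟩ := eq_and_parallel_of_not_abelian heff hrev hZ hHp hH0 htr hs' hab
      refine ⟨?_, hpar⟩
      have h2 := einsteinConstant_eq hrev hZ hHp hH0 hs' hpar
      rw [h1] at h2
      field_simp at h2
      linarith
  · push Not at hn
    have := subsingleton_of_nil_eq_zero heff hσ hrev hn
    refine ⟨fun _ => Subsingleton.elim _ _, fun _ =>
      ⟨fun _ => ⟨1, one_ne_zero, Subsingleton.elim _ _⟩,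
        fun _ => ⟨0, fun _ => Subsingleton.elim _ _⟩⟩,
      fun hab => absurd (fun X _ Y _ => Subsingleton.elim _ _) hab⟩
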